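/- **Corollary (Convergence of DP-Clipped-SGD for a non-convex objective).** Let $f(x)=\mathbb E_{\xi\sim\mathcal D}[f_\xi(x)]$ on $\mathbb R^d$. Fix $L,\Delta,\sigma,\lambda>0$, $\sigma_\omega\ge 0$, $\alpha\in(1,2]$, $\beta\in(0,1]$, an integer $K\ge 1$ and a starting point $x^0$. Let $$Q=\Big\{x\in\mathbb R^d:\ \exists\, y\in\mathbb R^d,\ f(y)\le f^*+2\Delta,\ \|x-y\|\le \tfrac{\sqrt\Delta}{20\sqrt L}\Big\},\qquad f^*=\inf_{x\in Q}f(x)>-\infty,\qquad f(x^0)-f^*\le\Delta .$$ Assume that for all $x,y\in Q$: $\|\nabla f(x)-\nabla f(y)\|\le L\|x-y\|$, $\ \mathbb E_\xi[\nabla f_\xi(x)]=\nabla f(x)$, and $\mathbb E_\xi\|\nabla f_\xi(x)-\nabla f(x)\|^\alpha\le\sigma^\alpha$. Consider the iterates $$x^{k+1}=x^k-\gamma\big(\min\{1,\lambda/\|\nabla f_{\xi^k}(x^k)\|\}\,\nabla f_{\xi^k}(x^k)+\omega_k\big),$$ where $\xi^0,\omega_0,\xi^1,\omega_1,\dots$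 are independent, $\xi^k\sim\mathcal D$ and $\omega_k\sim\mathcal N(0,\sigma_\omega^2 I_d)$. Put $$\zeta_\lambda=\max\{0,2\sqrt{L\Delta}-\tfrac\lambda2\},\quad S=\sigma^\alpha+\zeta_\lambda^\alpha,\quad B=\frac{\sqrt{L\Delta}}{\lambda}+\frac{\lambda^{\alpha-1}\zeta_\lambda}{S}+\sigma S^{-1/\alpha}.$$ Let $M>0$ and suppose that the clipping level satisfies $\lambda^\alpha\ln(K/\beta)\le M\,K\,S$. (For fixed parameters this holds for all sufficiently large $K$, and it holds whenever $\lambda\le M^{1/\alpha}\,\sigma\,(K/\ln(K/\beta))^{1/\alpha}$.) There is a constant $c_0>0$ depending only on $M$, and for each $c\in(0,c_0]$ a constant $C>0$ depending only on $M$ and $c$, such that if $$\gamma=c\cdot\min\left\{\frac1L,\ \frac{\sqrt{\Delta/L}}{\lambda^{1-\alpha/2}\sqrt{K S\ln(K/\beta)}},\ \frac{\sqrt{\Delta/L}\,\lambda^{\alpha-1}}{K S B},\ \frac{\sqrt{\Delta/L}}{\sigma_\omega\sqrt{dK\ln(K/\beta)}}\right\}$$ (a term with zero denominator is read as $+\infty$),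 then with probability at least $1-\beta$ $$\min_{0\le t\le K}\|\nabla f(x^t)\|^2\le C\,\max\{T_1,T_2,T_3,T_4\},$$ where $$T_1=\frac{L\Delta}{K}+\frac{L^2\Delta^2}{\lambda^2K^2},\qquad T_2=\sqrt{L\Delta}\,\lambda^{1-\alpha/2}\sqrt{\frac{S\ln(K/\beta)}{K}}+\frac{L\Delta\, S\ln(K/\beta)}{\lambda^\alpha K},$$ $$T_3=\frac{\sqrt{L\Delta}\,S B}{\lambda^{\alpha-1}}+\frac{L\Delta\,S^2B^2}{\lambda^{2\alpha}},\qquad T_4=\frac{\sigma_\omega\sqrt{dL\Delta\ln(K/\beta)}}{\sqrt K}+\frac{\sigma_\omega^2\,dL\Delta\ln(K/\beta)}{\lambda^2K}.$$ -/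

import Mathlib

open MeasureTheory ProbabilityTheory
open scoped Gradient ENNReal

noncomputable section

namespace DPClippedSGD

universe u

/-- The objective `f(x) = 𝔼_{ξ ∼ D} [f_ξ(x)]`, where `F ξ` is the loss `f_ξ` of the sample `ξ`. -/
def expectedLoss {d : ℕ} {Ξ : Type u} [MeasurableSpace Ξ] (D : Measure Ξ)
    (F : Ξ → EuclideanSpace ℝ (Fin d) → ℝ) (x : EuclideanSpace ℝ (Fin d)) : ℝ :=
  ∫ s, F s x ∂D

/-- The clipping operator `clip(v, lam) = min {1, lam / ‖v‖} v` (and `clip(0, lam) = 0`). -/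
def clip {d : ℕ} (lam : ℝ) (v : EuclideanSpace ℝ (Fin d)) : EuclideanSpace ℝ (Fin d) :=
  min 1 (lam / ‖v‖) • v

/-- The iterates `x^{k+1} = x^k - γ (clip(∇f_{ξ^k}(x^k), lam) + ω_k)` along the samples `ξ^k` and the
noise vectors `ω_k`. -/
def iterate {d : ℕ} {Ξ : Type u} (F : Ξ → EuclideanSpace ℝ (Fin d) → ℝ) (γ lam : ℝ)
    (x₀ : EuclideanSpace ℝ (Fin d)) (ξ : ℕ → Ξ) (w : ℕ → EuclideanSpace ℝ (Fin d)) :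
    ℕ → EuclideanSpace ℝ (Fin d)
  | 0 => x₀
  | k + 1 => iterate F γ lam x₀ ξ w k
      - γ • (clip lam (∇ (F (ξ k)) (iterate F γ lam x₀ ξ w k)) + w k)

/-- The set `Q` of points within `√Δ / (20 √L)` of the sublevel set `{f ≤ f* + 2Δ}`. -/
def region {d : ℕ} (f : EuclideanSpace ℝ (Fin d) → ℝ) (fstar L Δ : ℝ) :
    Set (EuclideanSpace ℝ (Fin d)) :=
  {x | ∃ y, f y ≤ fstar + 2 * Δ ∧ ‖x - y‖ ≤ √Δ / (20 * √L)}

/-- `f` is differentiable at the points of `Q` and `∇f` is `L`-Lipschitz on `Q`. -/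
structure SmoothOn {d : ℕ} (f : EuclideanSpace ℝ (Fin d) → ℝ) (L : ℝ)
    (Q : Set (EuclideanSpace ℝ (Fin d))) : Prop where
  differentiableAt : ∀ x ∈ Q, DifferentiableAt ℝ f x
  lipschitz : ∀ x ∈ Q, ∀ y ∈ Q, ‖∇ f x - ∇ f y‖ ≤ L * ‖x - y‖

/-- The expected loss and the stochastic gradients `∇f_ξ(x)` are well defined. -/
structure StochasticObjective {d : ℕ} {Ξ : Type u} [MeasurableSpace Ξ] (D : Measure Ξ)
    (F : Ξ → EuclideanSpace ℝ (Fin d) → ℝ) : Prop where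
  integrable : ∀ x, Integrable (fun s => F s x) D
  differentiable : ∀ s, Differentiable ℝ (F s)
  measurable_gradient :
    Measurable (fun p : Ξ × EuclideanSpace ℝ (Fin d) => ∇ (F p.1) p.2)

/-- On `Q` the stochastic gradient is unbiased, with central `α`-th moment at most `σ ^ α`. -/
structure HeavyTailedOracleOn {d : ℕ} {Ξ : Type u} [MeasurableSpace Ξ] (D : Measure Ξ)
    (F : Ξ → EuclideanSpace ℝ (Fin d) → ℝ) (α σ : ℝ)
    (Q : Set (EuclideanSpace ℝ (Fin d))) : Prop where
  integrable : ∀ x ∈ Q, Integrable (fun s => ∇ (F s) x) D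
  unbiased : ∀ x ∈ Q, ∫ s, ∇ (F s) x ∂D = ∇ (expectedLoss D F) x
  integrable_moment : ∀ x ∈ Q,
    Integrable (fun s => ‖∇ (F s) x - ∇ (expectedLoss D F) x‖ ^ α) D
  moment_le : ∀ x ∈ Q, ∫ s, ‖∇ (F s) x - ∇ (expectedLoss D F) x‖ ^ α ∂D ≤ σ ^ α

/-- `ζ = max {0, 2 √(LΔ) - lam / 2}`. -/
def zeta (L Δ lam : ℝ) : ℝ := max 0 (2 * √(L * Δ) - lam / 2)

/-- `σ ^ α + ζ ^ α`. -/
def noiseLevel (α σ L Δ lam : ℝ) : ℝ := σ ^ α + zeta L Δ lam ^ α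

/-- The factor
`√(LΔ) / lam + lam ^ (α - 1) ζ / (σ ^ α + ζ ^ α) + σ (σ ^ α + ζ ^ α) ^ (-1 / α)`. -/
def biasFactor (α σ L Δ lam : ℝ) : ℝ :=
  √(L * Δ) / lam + lam ^ (α - 1) * zeta L Δ lam / noiseLevel α σ L Δ lam
    + σ * noiseLevel α σ L Δ lam ^ (-1 / α)

/-- The minimum of the four terms of the step-size condition. The quotients are taken in `[0, ∞]`,
so that a term with denominator `0` (for instance when there is no DP noise) is `∞` and imposes no
restriction. The minimum is finite because of the term `1 / L`. -/
def stepsizeMin (d K : ℕ) (α σ σw L Δ lam β : ℝ) : ℝ :=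
  (min (ENNReal.ofReal (1 / L))
    (min (ENNReal.ofReal √(Δ / L) /
        ENNReal.ofReal (lam ^ (1 - α / 2)
          * √(K * Real.log (K / β) * noiseLevel α σ L Δ lam)))
    (min (ENNReal.ofReal (√(Δ / L) * lam ^ (α - 1)) /
        ENNReal.ofReal (K * noiseLevel α σ L Δ lam * biasFactor α σ L Δ lam))
      (ENNReal.ofReal √(Δ / L) /
        ENNReal.ofReal (σw * √(d * K * Real.log (K / β))))))).toReal

def optimizationTerm (K : ℕ) (L Δ lam : ℝ) : ℝ :=
  L * Δ / K + L ^ 2 * Δ ^ 2 / (lam ^ 2 * K ^ 2)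

def stochasticTerm (K : ℕ) (α σ L Δ lam β : ℝ) : ℝ :=
  √(L * Δ) * lam ^ (1 - α / 2) * √(noiseLevel α σ L Δ lam * Real.log (K / β) / K)
    + L * Δ * noiseLevel α σ L Δ lam * Real.log (K / β) / (lam ^ α * K)

def clippingBiasTerm (α σ L Δ lam : ℝ) : ℝ :=
  √(L * Δ) * noiseLevel α σ L Δ lam * biasFactor α σ L Δ lam / lam ^ (α - 1)
    + L * Δ * noiseLevel α σ L Δ lam ^ 2 * biasFactor α σ L Δ lam ^ 2 / lam ^ (2 * α)

def dpTerm (d K : ℕ) (σw L Δ lam β : ℝ) : ℝ :=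
  σw * √(d * L * Δ * Real.log (K / β)) / √K
    + σw ^ 2 * d * L * Δ * Real.log (K / β) / (lam ^ 2 * K)

/-- The samples `ξ^k ∼ D` and the noise vectors `ω_k ∼ N(0, σw² I)` are all jointly independent. -/
structure FreshSamples {d : ℕ} {Ξ Ω : Type*} [MeasurableSpace Ξ] [MeasurableSpace Ω]
    (P : Measure Ω) (D : Measure Ξ) (σw : ℝ)
    (ξ : ℕ → Ω → Ξ) (w : ℕ → Ω → EuclideanSpace ℝ (Fin d)) : Prop where
  measurable_sample : ∀ k, Measurable (ξ k)
  measurable_noise : ∀ k, Measurable (w k)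
  law_sample : ∀ k, P.map (ξ k) = D
  law_noise : ∀ k, P.map (w k) = multivariateGaussian 0 (σw ^ 2 • (1 : Matrix (Fin d) (Fin d) ℝ))
  indep_steps : iIndepFun (fun k ω => (ξ k ω, w k ω)) P
  indep_sample_noise : ∀ k, IndepFun (ξ k) (w k) P

end DPClippedSGD

end

/-! Put `A = log (K / β)` and `r = √(Δ / L)`. On the sublevel set `{f ≤ f* + 2Δ}` the gradient has
norm at most `2√(LΔ)`, and a step of length at most `r / 20` from it stays in `Q`. There the descent
inequality holds, and one step lowers `f` by `γ / 2 * ‖∇f‖ ^ 2` up to an error `stepError`. As long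
as the accumulated error is below `Δ`, the iterates remain in the sublevel set, and telescoping
bounds the smallest squared gradient by `4Δ / (γK)` (`TunedStepsize.trajectory_bound`).

The accumulated error is controlled by an exponential supermartingale argument. It is frozen on
reaching `Δ` or on leaving the sublevel set, so every active step starts where the oracle
assumptions hold. Each step multiplies the mean of `exp (2A / Δ * error)` by at most `exp (A / K)`
(`TunedStepsize.lintegral_exp_stepError_le`), so after `K` steps Markov's inequality gives failure
probability at most `exp (A - 2A) = β / K`. For the gradient sample, clipping makes the scaled error
bounded by `1`, and its first two moments follow from the `α`-th moment of the oracle. For the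
injected noise the Gaussian integrals are explicit. A large noise vector could carry the iterate out
of `Q`; the inflated coefficient in `stepError` makes such a step cost at least `2Δ`, which is
impossible while the accumulated error is below `Δ`.

This needs `3√(LΔ) ≤ lam`, so that true gradients lie well inside the clipping ball. Otherwise `ζ`
is comparable with `√(LΔ)`, and the clipping bias term already dominates the initial squared
gradient. The term attaining the minimum in the step-size rule determines which of the four error
terms bounds the rate. -/

section Descent

/-! ### Descent inequality along a segment. -/

variable {E : Type*} [NormedAddCommGroup E] [InnerProductSpace ℝ E] [CompleteSpace E]

/-- The descent lemma along a segment on which the gradient is `L`-Lipschitz. -/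
theorem descent_of_lipschitz_on_segment {f : E → ℝ} {L : ℝ} {x v : E}
    (hd : ∀ t ∈ Set.Icc (0 : ℝ) 1, DifferentiableAt ℝ f (x + t • v))
    (hL : ∀ t ∈ Set.Icc (0 : ℝ) 1, ‖∇ f (x + t • v) - ∇ f x‖ ≤ L * ‖t • v‖) :
    f (x + v) ≤ f x + inner ℝ (∇ f x) v + L / 2 * ‖v‖ ^ 2 := by
  -- The gap between `f` on the segment and its quadratic upper model; the Lipschitz bound makes its
  -- derivative nonpositive.
  let φ : ℝ → ℝ := fun t => f (x + t • v) - t * inner ℝ (∇ f x) v - L / 2 * t ^ 2 * ‖v‖ ^ 2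
  have hφ : ∀ t ∈ Set.Icc (0 : ℝ) 1, HasDerivAt φ
      (inner ℝ (∇ f (x + t • v)) v - inner ℝ (∇ f x) v - L * t * ‖v‖ ^ 2) t := by
    intro t ht
    have h1 : HasDerivAt (fun t : ℝ => x + t • v) v t := by
      simpa using ((hasDerivAt_id t).smul_const v).const_add x
    have h2 : HasDerivAt (fun t : ℝ => f (x + t • v)) (inner ℝ (∇ f (x + t • v)) v) t := by
      have := (hd t ht).hasGradientAt.hasFDerivAt.comp_hasDerivAt t h1
      rwa [InnerProductSpace.toDual_apply_apply] at this
    have h3 : HasDerivAt (fun t : ℝ => t * inner ℝ (∇ f x) v) (inner ℝ (∇ f x) v) t := by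
      simpa using (hasDerivAt_id t).mul_const (inner ℝ (∇ f x) v)
    have h4 : HasDerivAt (fun t : ℝ => L / 2 * t ^ 2 * ‖v‖ ^ 2) (L * t * ‖v‖ ^ 2) t := by
      have := (((hasDerivAt_id t).pow 2).const_mul (L / 2)).mul_const (‖v‖ ^ 2)
      refine this.congr_deriv ?_
      simp only [id, Nat.cast_ofNat]
      ring
    exact (h2.sub h3).sub h4
  have hanti : AntitoneOn φ (Set.Icc 0 1) := by
    refine antitoneOn_of_deriv_nonpos (convex_Icc 0 1)
      (fun t ht => (hφ t ht).continuousAt.continuousWithinAt)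
      (fun t ht => (hφ t (interior_subset ht)).differentiableAt.differentiableWithinAt) ?_
    intro t ht
    have ht' := interior_subset ht
    rw [(hφ t ht').deriv, ← inner_sub_left]
    have h := (real_inner_le_norm (∇ f (x + t • v) - ∇ f x) v).trans
      (mul_le_mul_of_nonneg_right (hL t ht') (norm_nonneg v))
    rw [norm_smul, Real.norm_of_nonneg ht'.1] at h
    nlinarith
  have := hanti (Set.left_mem_Icc.2 zero_le_one) (Set.right_mem_Icc.2 zero_le_one) zero_le_one
  simp only [φ, one_smul, zero_smul, add_zero, one_mul, zero_mul, sub_zero, one_pow, mul_one] at this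
  linarith

end Descent

/-! ### Geometry of the sublevel set and gradient bounds on it. -/

namespace DPClippedSGD

variable {d : ℕ} {f : EuclideanSpace ℝ (Fin d) → ℝ} {fstar L Δ : ℝ}

/-- The sublevel set `{f ≤ f* + 2Δ}`. -/
def sublevel (f : EuclideanSpace ℝ (Fin d) → ℝ) (fstar Δ : ℝ) :
    Set (EuclideanSpace ℝ (Fin d)) := {x | f x ≤ fstar + 2 * Δ}

theorem radius_eq (hΔ : 0 < Δ) : √Δ / (20 * √L) = √(Δ / L) / 20 := by
  rw [Real.sqrt_div hΔ.le, div_div, mul_comm]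

theorem mem_region_of_mem_sublevel {x y : EuclideanSpace ℝ (Fin d)} (hΔ : 0 < Δ)
    (hy : y ∈ sublevel f fstar Δ) (hxy : ‖x - y‖ ≤ √(Δ / L) / 20) : x ∈ region f fstar L Δ :=
  ⟨y, hy, by rwa [radius_eq hΔ]⟩

theorem sublevel_subset_region (hL : 0 < L) (hΔ : 0 < Δ) :
    sublevel f fstar Δ ⊆ region f fstar L Δ := fun x hx =>
  mem_region_of_mem_sublevel hΔ hx (by simp; positivity)

/-- Continuity of `f` is known only on `Q`, but a limit of points of the sublevel set is within the
radius of one of them, hence in `Q`. Closedness supplies the measurability of the stopping rule. -/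
theorem isClosed_sublevel (hL : 0 < L) (hΔ : 0 < Δ)
    (hf : SmoothOn f L (region f fstar L Δ)) : IsClosed (sublevel f fstar Δ) := by
  rw [← isSeqClosed_iff_isClosed]
  intro u x hu hx
  have hr : 0 < √(Δ / L) / 20 := by positivity
  obtain ⟨n, hn⟩ := (Metric.tendsto_atTop.1 hx) _ hr
  have hxQ : x ∈ region f fstar L Δ := by
    refine mem_region_of_mem_sublevel hΔ (hu n) ?_
    rw [← dist_eq_norm, dist_comm]
    exact (hn n le_rfl).le
  exact le_of_tendsto ((hf.differentiableAt x hxQ).continuousAt.tendsto.comp hx)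
    (Filter.Eventually.of_forall hu)

theorem descent_step (hL : 0 < L) (hΔ : 0 < Δ) (hf : SmoothOn f L (region f fstar L Δ))
    {x v : EuclideanSpace ℝ (Fin d)} (hx : x ∈ sublevel f fstar Δ) (hv : ‖v‖ ≤ √(Δ / L) / 20) :
    f (x + v) ≤ f x + inner ℝ (∇ f x) v + L / 2 * ‖v‖ ^ 2 := by
  have hmem : ∀ t ∈ Set.Icc (0 : ℝ) 1, x + t • v ∈ region f fstar L Δ := fun t ht =>
    mem_region_of_mem_sublevel hΔ hx (by
      rw [add_sub_cancel_left, norm_smul, Real.norm_of_nonneg ht.1]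
      nlinarith [ht.2, norm_nonneg v])
  refine descent_of_lipschitz_on_segment (fun t ht => hf.differentiableAt _ (hmem t ht)) ?_
  intro t ht
  simpa using hf.lipschitz _ (hmem t ht) _ (sublevel_subset_region hL hΔ hx)

/-- The usual argument compares `f x` with `f (x - ∇f(x) / L)`, but that point is not known in
advance to lie in `Q`. The segment is therefore traversed in short pieces: `f` does not exceed `f x`
on the part already covered, so that part lies in the sublevel set and the next piece lies in `Q`.
-/
theorem norm_gradient_sq_le (hL : 0 < L) (hΔ : 0 < Δ) (hf : SmoothOn f L (region f fstar L Δ))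
    (hinf : ∀ y ∈ region f fstar L Δ, fstar ≤ f y)
    {x : EuclideanSpace ℝ (Fin d)} (hx : x ∈ sublevel f fstar Δ) :
    ‖∇ f x‖ ^ 2 ≤ 2 * L * (f x - fstar) := by
  have hr : 0 < √(Δ / L) / 20 := by positivity
  set g := ∇ f x with hg
  let p : ℝ → EuclideanSpace ℝ (Fin d) := fun t => x + (-(t / L)) • g
  have hp : ∀ t : ℝ, 0 ≤ t → t ≤ 1 → (∀ u ∈ Set.Icc 0 t, p u ∈ region f fstar L Δ) →
      f (p t) ≤ f x - t / L * (1 - t / 2) * ‖g‖ ^ 2 := by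
    intro t ht0 ht1 hu
    have hseg : ∀ a ∈ Set.Icc (0 : ℝ) 1, x + a • (-(t / L)) • g ∈ region f fstar L Δ := by
      intro a ha
      have := hu (a * t) ⟨mul_nonneg ha.1 ht0, mul_le_of_le_one_left ht0 ha.2⟩
      simp only [p] at this
      rwa [smul_smul, show a * -(t / L) = -(a * t / L) by ring]
    have := descent_of_lipschitz_on_segment (f := f) (L := L) (x := x) (v := (-(t / L)) • g)
      (fun a ha => hf.differentiableAt _ (hseg a ha)) (fun a ha => by
        simpa using hf.lipschitz _ (hseg a ha) _ (sublevel_subset_region hL hΔ hx))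
    refine this.trans (le_of_eq ?_)
    rw [← hg, inner_smul_right, real_inner_self_eq_norm_sq, norm_smul, norm_neg, Real.norm_of_nonneg
      (by positivity)]
    field_simp
    ring
  -- With `N` pieces, each has length `‖g‖ / (L * N)`, below the radius defining `Q`.
  obtain ⟨N, hN⟩ := exists_nat_gt (‖g‖ / L / (√(Δ / L) / 20))
  have hN0 : 0 < (N : ℝ) := lt_of_le_of_lt (by positivity) hN
  have key : ∀ n : ℕ, n ≤ N → ∀ t ∈ Set.Icc (0 : ℝ) (n / N), p t ∈ sublevel f fstar Δ := by
    intro n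
    induction n with
    | zero =>
      intro _ t ht
      have : t = 0 := le_antisymm (by simpa using ht.2) ht.1
      simpa [p, this] using hx
    | succ n ih =>
      intro hn t ht
      have ih := ih (by omega)
      have hreg : ∀ u ∈ Set.Icc 0 t, p u ∈ region f fstar L Δ := by
        intro u hu
        by_cases hun : u ≤ n / N
        · exact sublevel_subset_region hL hΔ (ih u ⟨hu.1, hun⟩)
        · refine mem_region_of_mem_sublevel hΔ
            (ih (n / N) ⟨by positivity, le_rfl⟩) ?_
          have e : p u - p (n / N) = (-((u - n / N) / L)) • g := by
            simp only [p]
            rw [add_sub_add_left_eq_sub, ← sub_smul]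
            congr 1
            ring
          push Not at hun
          rw [e, norm_smul, norm_neg, Real.norm_of_nonneg
            (div_nonneg (by linarith) hL.le)]
          have h1 : u - n / N ≤ 1 / N := by
            have := hu.2.trans ht.2
            push_cast at this
            rw [add_div] at this
            linarith
          rw [div_lt_iff₀ hr] at hN
          calc (u - n / N) / L * ‖g‖ = (u - n / N) * (‖g‖ / L) := by ring
            _ ≤ 1 / N * (N * (√(Δ / L) / 20)) := by gcongr
            _ = _ := by field_simp
      have ht1 : t ≤ 1 := ht.2.trans (by
        rw [div_le_one hN0]; exact_mod_cast hn)
      have := hp t ht.1 ht1 hreg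
      have hnn : 0 ≤ t / L * (1 - t / 2) * ‖g‖ ^ 2 :=
        mul_nonneg (mul_nonneg (div_nonneg ht.1 hL.le) (by linarith)) (by positivity)
      have hx' : f x ≤ fstar + 2 * Δ := hx
      change f (p t) ≤ fstar + 2 * Δ
      linarith
  have hone : ((N : ℕ) : ℝ) / N = 1 := div_self hN0.ne'
  have hall : ∀ t ∈ Set.Icc (0 : ℝ) 1, p t ∈ region f fstar L Δ := fun t ht =>
    sublevel_subset_region hL hΔ (key N le_rfl t (by rwa [hone]))
  have h1 := hp 1 zero_le_one le_rfl hall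
  have h2 := hinf _ (hall 1 (by simp))
  have h3 : 1 / L * (1 - 1 / 2) * ‖g‖ ^ 2 ≤ f x - fstar := by linarith
  have h4 := mul_le_mul_of_nonneg_left h3 (by positivity : 0 ≤ 2 * L)
  refine le_trans (le_of_eq ?_) h4
  field_simp
  norm_num

theorem norm_gradient_le (hL : 0 < L) (hΔ : 0 < Δ) (hf : SmoothOn f L (region f fstar L Δ))
    (hinf : ∀ y ∈ region f fstar L Δ, fstar ≤ f y)
    {x : EuclideanSpace ℝ (Fin d)} (hx : x ∈ sublevel f fstar Δ) :
    ‖∇ f x‖ ≤ 2 * √(L * Δ) := by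
  refine abs_le_of_sq_le_sq' ?_ (by positivity) |>.2
  rw [mul_pow, Real.sq_sqrt (by positivity)]
  have := norm_gradient_sq_le hL hΔ hf hinf hx
  have hx' : f x ≤ fstar + 2 * Δ := hx
  nlinarith

theorem measurable_gradient (f : EuclideanSpace ℝ (Fin d) → ℝ) : Measurable (∇ f) := by
  have := measurable_fderiv ℝ f
  exact (InnerProductSpace.toDual ℝ (EuclideanSpace ℝ (Fin d))).symm.continuous.measurable.comp this

end DPClippedSGD

/-! ### Clipped stochastic gradients: bias, second moment and exponential moment. -/

/-- The exponential moment of a variable with values in `[-1, 1]` is controlled by its first two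
moments. -/
theorem lintegral_exp_le_of_abs_le_one {Ξ : Type*} [MeasurableSpace Ξ] {D : Measure Ξ}
    [IsProbabilityMeasure D] {Z : Ξ → ℝ} (hZ : Measurable Z) (h1 : ∀ s, |Z s| ≤ 1) {m₁ m₂ : ℝ}
    (hm₁ : ∫ s, Z s ∂D ≤ m₁) (hm₂ : ∫ s, Z s ^ 2 ∂D ≤ m₂) :
    ∫⁻ s, ENNReal.ofReal (Real.exp (Z s)) ∂D ≤ ENNReal.ofReal (Real.exp (m₁ + m₂)) := by
  have hi : Integrable Z D := Integrable.of_bound hZ.aestronglyMeasurable 1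
    (Filter.Eventually.of_forall h1)
  have hi2 : Integrable (fun s => Z s ^ 2) D :=
    Integrable.of_bound (hZ.pow_const 2).aestronglyMeasurable 1
      (Filter.Eventually.of_forall fun s => by
        rw [Real.norm_eq_abs, abs_pow]; exact pow_le_one₀ (abs_nonneg _) (h1 s))
  have hie : Integrable (fun s => 1 + Z s + Z s ^ 2) D :=
    ((integrable_const 1).add hi).add hi2
  have hle : ∀ s, Real.exp (Z s) ≤ 1 + Z s + Z s ^ 2 := fun s => by
    have := (abs_le.1 (Real.abs_exp_sub_one_sub_id_le (h1 s))).2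
    linarith
  calc ∫⁻ s, ENNReal.ofReal (Real.exp (Z s)) ∂D
      ≤ ∫⁻ s, ENNReal.ofReal (1 + Z s + Z s ^ 2) ∂D :=
        lintegral_mono fun s => ENNReal.ofReal_le_ofReal (hle s)
    _ = ENNReal.ofReal (∫ s, (1 + Z s + Z s ^ 2) ∂D) :=
        (ofReal_integral_eq_lintegral_ofReal hie (Filter.Eventually.of_forall fun s =>
          (Real.exp_pos _).le.trans (hle s))).symm
    _ ≤ ENNReal.ofReal (Real.exp (m₁ + m₂)) := by
        refine ENNReal.ofReal_le_ofReal ?_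
        have e : ∫ s, (1 + Z s + Z s ^ 2) ∂D = 1 + ∫ s, Z s ∂D + ∫ s, Z s ^ 2 ∂D := by
          rw [integral_add (f := fun s => 1 + Z s) ((integrable_const 1).add hi) hi2,
            integral_add (integrable_const 1) hi]
          simp
        rw [e]
        have := Real.add_one_le_exp (m₁ + m₂)
        linarith

namespace DPClippedSGD

variable {d : ℕ} {lam α : ℝ} {v G : EuclideanSpace ℝ (Fin d)}

theorem clip_of_norm_le (hv : ‖v‖ ≤ lam) : clip lam v = v := by
  rcases eq_or_ne v 0 with rfl | h0
  · simp [clip]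
  · have : 0 < ‖v‖ := norm_pos_iff.2 h0
    rw [clip, min_eq_left ((one_le_div this).2 hv), one_smul]

theorem norm_clip_sub_self (hlam : 0 < lam) (hv : lam ≤ ‖v‖) :
    ‖clip lam v - v‖ = ‖v‖ - lam := by
  have h0 : 0 < ‖v‖ := hlam.trans_le hv
  have h1 : lam / ‖v‖ ≤ 1 := (div_le_one h0).2 hv
  have : clip lam v - v = -((1 - lam / ‖v‖) • v) := by
    rw [clip, min_eq_right h1]; module
  rw [this, norm_neg, norm_smul, Real.norm_of_nonneg (by linarith)]
  field_simp

theorem norm_clip_le (hlam : 0 < lam) (v : EuclideanSpace ℝ (Fin d)) : ‖clip lam v‖ ≤ lam := by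
  rcases le_total ‖v‖ lam with h | h
  · rwa [clip_of_norm_le h]
  · have h0 : 0 < ‖v‖ := hlam.trans_le h
    rw [clip, min_eq_right ((div_le_one h0).2 h), norm_smul, Real.norm_of_nonneg (by positivity)]
    exact (div_mul_cancel₀ _ h0.ne').le

theorem norm_clip_sub_self_le (hlam : 0 < lam) (hG : ‖G‖ ≤ lam) :
    ‖clip lam v - v‖ ≤ ‖v - G‖ := by
  rcases le_total ‖v‖ lam with h | h
  · simp [clip_of_norm_le h]
  · rw [norm_clip_sub_self hlam h]
    have := norm_sub_norm_le v G
    linarith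

/-- Clipping acts only if `lam ≤ ‖v‖`, and then `‖v - G‖ ≥ lam / 3`. Hence the missing power `α - 1`
of `‖v - G‖` can be inserted at the price of `lam ^ (1 - α)` and `3 ^ (α - 1) ≤ 3`. -/
theorem norm_clip_sub_self_le_rpow (hlam : 0 < lam) (hα : 1 < α) (hα2 : α ≤ 2)
    (hG : ‖G‖ ≤ 2 * lam / 3) :
    ‖clip lam v - v‖ ≤ 3 * lam ^ (1 - α) * ‖v - G‖ ^ α := by
  rcases le_total ‖v‖ lam with h | h
  · rw [clip_of_norm_le h, sub_self, norm_zero]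
    positivity
  · have h1 : lam / 3 ≤ ‖v - G‖ := by
      have := norm_sub_norm_le v G
      linarith
    have h0 : 0 < ‖v - G‖ := lt_of_lt_of_le (by positivity) h1
    have h2 : lam ≤ 3 * ‖v - G‖ := by linarith
    refine (norm_clip_sub_self_le hlam (by linarith : ‖G‖ ≤ lam)).trans ?_
    have h3 : lam ^ (α - 1) ≤ 3 * ‖v - G‖ ^ (α - 1) := by
      calc lam ^ (α - 1) ≤ (3 * ‖v - G‖) ^ (α - 1) := by gcongr
        _ = 3 ^ (α - 1) * ‖v - G‖ ^ (α - 1) := Real.mul_rpow (by norm_num) h0.le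
        _ ≤ 3 ^ (1 : ℝ) * ‖v - G‖ ^ (α - 1) := by
          gcongr
          · norm_num
          · linarith
        _ = _ := by rw [Real.rpow_one]
    have e1 : lam ^ (1 - α) * lam ^ (α - 1) = 1 := by
      rw [← Real.rpow_add hlam]; simp
    have e2 : ‖v - G‖ ^ α = ‖v - G‖ ^ (α - 1) * ‖v - G‖ := by
      rw [← Real.rpow_add_one h0.ne', sub_add_cancel]
    calc ‖v - G‖ = lam ^ (1 - α) * lam ^ (α - 1) * ‖v - G‖ := by rw [e1, one_mul]
      _ ≤ lam ^ (1 - α) * (3 * ‖v - G‖ ^ (α - 1)) * ‖v - G‖ := by gcongr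
      _ = _ := by rw [e2]; ring

theorem norm_clip_sub_le (hlam : 0 < lam) (hG : ‖G‖ ≤ lam) : ‖clip lam v - G‖ ≤ 2 * lam :=
  (norm_sub_le _ _).trans (by linarith [norm_clip_le hlam v])

/-- Interpolation: of the two factors, the power `2 - α` is bounded by the range `2 * lam` and the
power `α` by `2 * ‖v - G‖`. -/
theorem norm_clip_sub_sq_le (hlam : 0 < lam) (hα : 1 < α) (hα2 : α ≤ 2) (hG : ‖G‖ ≤ lam) :
    ‖clip lam v - G‖ ^ 2 ≤ 8 * lam ^ (2 - α) * ‖v - G‖ ^ α := by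
  have h1 : ‖clip lam v - G‖ ≤ 2 * ‖v - G‖ := by
    have := norm_add_le (clip lam v - v) (v - G)
    rw [sub_add_sub_cancel] at this
    linarith [norm_clip_sub_self_le (v := v) hlam hG]
  have h2 := norm_clip_sub_le (v := v) hlam hG
  rcases (norm_nonneg (clip lam v - G)).eq_or_lt with h0 | h0
  · rw [← h0, zero_pow two_ne_zero]; positivity
  · have two : ∀ {a : ℝ}, (2 : ℝ) ^ a * 2 ^ (2 - a) = 4 := fun {a} => by
      rw [← Real.rpow_add (by norm_num)]; norm_num
    calc ‖clip lam v - G‖ ^ 2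
        = ‖clip lam v - G‖ ^ (2 - α) * ‖clip lam v - G‖ ^ α := by
          rw [← Real.rpow_add h0]; norm_num
      _ ≤ (2 * lam) ^ (2 - α) * (2 * ‖v - G‖) ^ α := by gcongr
      _ = (2 ^ α * 2 ^ (2 - α)) * (lam ^ (2 - α) * ‖v - G‖ ^ α) := by
          rw [Real.mul_rpow (by norm_num) hlam.le, Real.mul_rpow (by norm_num) (norm_nonneg _)]
          ring
      _ ≤ 8 * (lam ^ (2 - α) * ‖v - G‖ ^ α) := by
          rw [two]; gcongr; norm_num
      _ = _ := by ring

theorem measurable_clip : Measurable (clip lam : EuclideanSpace ℝ (Fin d) → _) := by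
  unfold clip
  fun_prop

section Oracle

variable {Ξ : Type*} [MeasurableSpace Ξ] {D : Measure Ξ} [IsProbabilityMeasure D]
  {g : Ξ → EuclideanSpace ℝ (Fin d)} {s : ℝ}

theorem integral_norm_clip_sub_sq_le (hg : Measurable g)
    (hm : Integrable (fun i => ‖g i - G‖ ^ α) D) (hs : ∫ i, ‖g i - G‖ ^ α ∂D ≤ s * lam ^ α)
    (hlam : 0 < lam) (hα : 1 < α) (hα2 : α ≤ 2) (hG : ‖G‖ ≤ lam) :
    ∫ i, ‖clip lam (g i) - G‖ ^ 2 ∂D ≤ 8 * lam ^ 2 * s := by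
  have := measurable_clip (d := d) (lam := lam)
  calc ∫ i, ‖clip lam (g i) - G‖ ^ 2 ∂D ≤ ∫ i, 8 * lam ^ (2 - α) * ‖g i - G‖ ^ α ∂D := by
        refine integral_mono ?_ (hm.const_mul _) fun i => norm_clip_sub_sq_le hlam hα hα2 hG
        refine Integrable.of_bound (C := (2 * lam) ^ 2) (Measurable.aestronglyMeasurable (by fun_prop))
          (Filter.Eventually.of_forall fun i => ?_)
        rw [Real.norm_of_nonneg (by positivity)]
        gcongr
        exact norm_clip_sub_le hlam hG
    _ = 8 * lam ^ (2 - α) * ∫ i, ‖g i - G‖ ^ α ∂D := integral_const_mul _ _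
    _ ≤ 8 * lam ^ (2 - α) * (s * lam ^ α) := by gcongr
    _ = 8 * (lam ^ (2 - α) * lam ^ α) * s := by ring
    _ = 8 * lam ^ 2 * s := by rw [← Real.rpow_add hlam]; norm_num

theorem neg_integral_inner_clip_sub_le (hg : Integrable g D) (hgG : ∫ i, g i ∂D = G)
    (hg' : Measurable g)
    (hm : Integrable (fun i => ‖g i - G‖ ^ α) D) (hs : ∫ i, ‖g i - G‖ ^ α ∂D ≤ s * lam ^ α)
    (hlam : 0 < lam) (hα : 1 < α) (hα2 : α ≤ 2) (hG : ‖G‖ ≤ 2 * lam / 3) :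
    -∫ i, inner ℝ G (clip lam (g i) - G) ∂D ≤ ‖G‖ * (3 * lam * s) := by
  have := measurable_clip (d := d) (lam := lam)
  have hc : Integrable (fun i => clip lam (g i)) D :=
    Integrable.of_bound (C := lam) (Measurable.aestronglyMeasurable (by fun_prop))
      (Filter.Eventually.of_forall fun i => norm_clip_le hlam _)
  -- Unbiasedness replaces `G` by `g i`, so only the clipped-off part contributes to the bias.
  have e : ∫ i, inner ℝ G (clip lam (g i) - G) ∂D = ∫ i, inner ℝ G (clip lam (g i) - g i) ∂D := by
    have e1 := integral_inner (𝕜 := ℝ) (hc.sub (integrable_const G)) G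
    have e2 := integral_inner (𝕜 := ℝ) (hc.sub hg) G
    simp only [Pi.sub_apply] at e1 e2
    rw [e1, e2, integral_sub hc (integrable_const G), integral_sub hc hg, hgG]
    simp
  rw [e, ← integral_neg]
  calc ∫ i, -inner ℝ G (clip lam (g i) - g i) ∂D
      ≤ ∫ i, ‖G‖ * (3 * lam ^ (1 - α) * ‖g i - G‖ ^ α) ∂D := by
        refine integral_mono (((hc.sub hg).const_inner G).neg) ((hm.const_mul _).const_mul _)
          fun i => ?_
        refine (neg_le_abs _).trans ((abs_real_inner_le_norm _ _).trans ?_)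
        gcongr
        exact norm_clip_sub_self_le_rpow hlam hα hα2 hG
    _ = ‖G‖ * (3 * lam ^ (1 - α) * ∫ i, ‖g i - G‖ ^ α ∂D) := by
        rw [integral_const_mul, integral_const_mul]
    _ ≤ ‖G‖ * (3 * lam ^ (1 - α) * (s * lam ^ α)) := by gcongr
    _ = ‖G‖ * (3 * (lam ^ (1 - α) * lam ^ α) * s) := by ring
    _ = ‖G‖ * (3 * lam * s) := by rw [← Real.rpow_add hlam]; norm_num

end Oracle

/-! ### Tuned step sizes and the exponential moment of the sampling error. -/

/-- The consequences of the step-size rule, in terms of `A = log (K / β)`, `r = √(Δ / L)` and the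
relative noise level `s = (σ ^ α + ζ ^ α) / lam ^ α`. -/
structure TunedStepsize (d : ℕ) (K A s L r lam σw γ : ℝ) : Prop where
  one_le_K : 1 ≤ K
  half_le_A : 1 / 2 ≤ A
  s_pos : 0 < s
  L_pos : 0 < L
  r_pos : 0 < r
  lam_pos : 0 < lam
  γ_pos : 0 < γ
  smoothness : γ * L ≤ 1 / 600
  variance : γ ^ 2 * lam ^ 2 * K * A * s ≤ r ^ 2 / 360000
  bias : γ * K * s * lam ≤ r / 150
  range : γ * lam * A ≤ r / 80
  noise : γ ^ 2 * σw ^ 2 * d * K * A ≤ r ^ 2 / 360000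

namespace TunedStepsize

variable {K A s L r σw γ : ℝ}

theorem A_pos (h : TunedStepsize d K A s L r lam σw γ) : 0 < A :=
  lt_of_lt_of_le (by norm_num) h.half_le_A

theorem γ_mul_lam_le (h : TunedStepsize d K A s L r lam σw γ) : γ * lam ≤ r / 40 := by
  have := mul_pos h.γ_pos h.lam_pos
  nlinarith [h.range, h.half_le_A]

/-- The contribution of the gradient sample to the error of one step. -/
theorem abs_sampleError_le (h : TunedStepsize d K A s L r lam σw γ) (hG : ‖G‖ ≤ 2 * (L * r))
    (hGl : ‖G‖ ≤ lam) :
    |-γ * inner ℝ G (clip lam v - G) + 2 * L * γ ^ 2 * ‖clip lam v - G‖ ^ 2|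
      ≤ 4 * γ * L * r * ‖clip lam v - G‖ := by
  have hX := norm_clip_sub_le (v := v) h.lam_pos hGl
  have hγ := h.γ_pos
  have hL := h.L_pos
  set X := clip lam v - G
  have h1 : |inner ℝ G X| ≤ 2 * (L * r) * ‖X‖ :=
    (abs_real_inner_le_norm _ _).trans (by gcongr)
  have h2 : γ * ‖X‖ ≤ r / 20 :=
    (mul_le_mul_of_nonneg_left hX hγ.le).trans (by linarith [h.γ_mul_lam_le])
  calc _ ≤ |-γ * inner ℝ G X| + |2 * L * γ ^ 2 * ‖X‖ ^ 2| := abs_add_le _ _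
    _ = γ * |inner ℝ G X| + 2 * L * γ * ‖X‖ * (γ * ‖X‖) := by
      rw [abs_mul, abs_neg, abs_of_pos hγ,
        abs_of_nonneg (by positivity : 0 ≤ 2 * L * γ ^ 2 * ‖X‖ ^ 2)]
      ring
    _ ≤ γ * (2 * (L * r) * ‖X‖) + 2 * L * γ * ‖X‖ * r := by
      have : γ * ‖X‖ ≤ r := by linarith [h.r_pos]
      gcongr
    _ = _ := by ring

/-- The factor `4 * A / (L * r ^ 2)` is twice the exponent `2 * A / Δ` of the supermartingale, since
sampling error and noise error are later separated by the arithmetic-geometric mean inequality. -/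
theorem lintegral_exp_sampleError_le {Ξ : Type*} [MeasurableSpace Ξ] {D : Measure Ξ}
    [IsProbabilityMeasure D] {g : Ξ → EuclideanSpace ℝ (Fin d)}
    (h : TunedStepsize d K A s L r lam σw γ) (hg : Integrable g D) (hgG : ∫ i, g i ∂D = G)
    (hg' : Measurable g)
    (hm : Integrable (fun i => ‖g i - G‖ ^ α) D) (hs : ∫ i, ‖g i - G‖ ^ α ∂D ≤ s * lam ^ α)
    (hα : 1 < α) (hα2 : α ≤ 2) (hG : ‖G‖ ≤ 2 * lam / 3) (hGL : ‖G‖ ≤ 2 * (L * r)) :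
    ∫⁻ i, ENNReal.ofReal (Real.exp (4 * A / (L * r ^ 2) *
      (-γ * inner ℝ G (clip lam (g i) - G) + 2 * L * γ ^ 2 * ‖clip lam (g i) - G‖ ^ 2))) ∂D
      ≤ ENNReal.ofReal (Real.exp (A / K)) := by
  have hlam := h.lam_pos
  have hL := h.L_pos
  have hγ := h.γ_pos
  have hr := h.r_pos
  have hA := h.A_pos
  have hK : 0 < K := zero_lt_one.trans_le h.one_le_K
  have hs0 := h.s_pos
  have hGl : ‖G‖ ≤ lam := by linarith
  have hcm := measurable_clip (d := d) (lam := lam)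
  have hY := fun i => h.abs_sampleError_le (v := g i) hGL hGl
  have hX2 := integral_norm_clip_sub_sq_le hg' hm hs hlam hα hα2 hGl
  have hX1 := neg_integral_inner_clip_sub_le hg hgG hg' hm hs hlam hα hα2 hG
  have hXb : ∀ i, ‖clip lam (g i) - G‖ ≤ 2 * lam := fun i => norm_clip_sub_le hlam hGl
  have hXi : Integrable (fun i => clip lam (g i) - G) D :=
    Integrable.of_bound (C := 2 * lam) (Measurable.aestronglyMeasurable (by fun_prop)) (Filter.Eventually.of_forall hXb)
  have hX2i : Integrable (fun i => ‖clip lam (g i) - G‖ ^ 2) D := by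
    refine Integrable.of_bound (C := (2 * lam) ^ 2) (Measurable.aestronglyMeasurable (by fun_prop))
      (Filter.Eventually.of_forall fun i => ?_)
    rw [Real.norm_of_nonneg (by positivity)]
    gcongr
    exact hXb i
  set τ := 4 * A / (L * r ^ 2) with hτ
  have hτ0 : 0 < τ := by positivity
  have hvar : γ ^ 2 * lam ^ 2 * s * A ≤ r ^ 2 / 360000 / K := by
    rw [le_div_iff₀ hK]; linarith [h.variance]
  have hbias : γ * s * lam ≤ r / 150 / K := by
    rw [le_div_iff₀ hK]; linarith [h.bias]
  have m1 : ∫ i, τ * (-γ * inner ℝ G (clip lam (g i) - G) +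
      2 * L * γ ^ 2 * ‖clip lam (g i) - G‖ ^ 2) ∂D ≤ A / K * (1 / 2) := by
    rw [integral_const_mul, integral_add ((hXi.const_inner G).const_mul _) (hX2i.const_mul _),
      integral_const_mul, integral_const_mul]
    have e1 : -γ * ∫ i, inner ℝ G (clip lam (g i) - G) ∂D ≤ γ * (2 * (L * r) * (3 * lam * s)) := by
      rw [neg_mul, ← mul_neg]
      refine mul_le_mul_of_nonneg_left (hX1.trans ?_) hγ.le
      gcongr
    have e2 : 2 * L * γ ^ 2 * ∫ i, ‖clip lam (g i) - G‖ ^ 2 ∂D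
        ≤ 2 * L * γ ^ 2 * (8 * lam ^ 2 * s) := by gcongr
    calc _ ≤ τ * (γ * (2 * (L * r) * (3 * lam * s)) + 2 * L * γ ^ 2 * (8 * lam ^ 2 * s)) := by
          gcongr
      _ = 24 * A / r * (γ * s * lam) + 64 / r ^ 2 * (γ ^ 2 * lam ^ 2 * s * A) := by
          rw [hτ]; field_simp; ring
      _ ≤ 24 * A / r * (r / 150 / K) + 64 / r ^ 2 * (r ^ 2 / 360000 / K) := by gcongr
      _ = A / K * (24 / 150) + 1 / K * (64 / 360000) := by field_simp
      -- The second-order contribution carries no factor `A`; it is absorbed using `1 ≤ 2 * A`.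
      _ ≤ A / K * (24 / 150) + 2 * A / K * (64 / 360000) := by
          gcongr
          linarith [h.half_le_A]
      _ = A / K * (24 / 150 + 128 / 360000) := by ring
      _ ≤ _ := by gcongr; norm_num
  have m2 : ∫ i, (τ * (-γ * inner ℝ G (clip lam (g i) - G) +
      2 * L * γ ^ 2 * ‖clip lam (g i) - G‖ ^ 2)) ^ 2 ∂D ≤ A / K * (1 / 2) := by
    -- The pointwise bound, linear in `‖clip lam (g i) - G‖`, reduces the second moment to that of
    -- the clipped gradient.
    calc _ ≤ ∫ i, τ ^ 2 * (4 * γ * L * r) ^ 2 * ‖clip lam (g i) - G‖ ^ 2 ∂D := by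
          refine integral_mono_of_nonneg (Filter.Eventually.of_forall fun i => by positivity)
            (hX2i.const_mul _) (Filter.Eventually.of_forall fun i => ?_)
          dsimp only
          rw [mul_pow, mul_assoc (τ ^ 2), ← mul_pow (4 * γ * L * r)]
          exact mul_le_mul_of_nonneg_left (sq_le_sq.2 ((hY i).trans (le_abs_self _)))
            (by positivity)
      _ = τ ^ 2 * (4 * γ * L * r) ^ 2 * ∫ i, ‖clip lam (g i) - G‖ ^ 2 ∂D := integral_const_mul _ _
      _ ≤ τ ^ 2 * (4 * γ * L * r) ^ 2 * (8 * lam ^ 2 * s) := by gcongr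
      _ = 2048 * A / r ^ 2 * (γ ^ 2 * lam ^ 2 * s * A) := by rw [hτ]; field_simp; ring
      _ ≤ 2048 * A / r ^ 2 * (r ^ 2 / 360000 / K) := by gcongr
      _ = A / K * (2048 / 360000) := by field_simp
      _ ≤ _ := mul_le_mul_of_nonneg_left (by norm_num) (by positivity)
  -- The scaled error is at most `32 / 80`, by clipping and the range condition on `γ * lam * A`.
  refine (lintegral_exp_le_of_abs_le_one (by fun_prop) (fun i => ?_) m1 m2).trans_eq ?_
  · rw [abs_mul, abs_of_pos hτ0]
    calc _ ≤ τ * (4 * γ * L * r * (2 * lam)) := by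
          gcongr
          exact (hY i).trans (by gcongr; exact hXb i)
      _ = 32 / r * (γ * lam * A) := by rw [hτ]; field_simp; ring
      _ ≤ 32 / r * (r / 80) := by gcongr; exact h.range
      _ ≤ 1 := by rw [show 32 / r * (r / 80) = 32 / 80 by field_simp]; norm_num
  · congr 2; ring

end TunedStepsize

end DPClippedSGD

/-! ### Exponential moments of the Gaussian noise. -/

theorem lintegral_exp_add_le {Ω : Type*} [MeasurableSpace Ω] {P : Measure Ω} {U V : Ω → ℝ}
    (hU : Measurable U) (hV : Measurable V) {q : ℝ≥0∞}
    (hUq : ∫⁻ ω, ENNReal.ofReal (Real.exp (2 * U ω)) ∂P ≤ q)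
    (hVq : ∫⁻ ω, ENNReal.ofReal (Real.exp (2 * V ω)) ∂P ≤ q) :
    ∫⁻ ω, ENNReal.ofReal (Real.exp (U ω + V ω)) ∂P ≤ q := by
  have hle : ∀ ω, ENNReal.ofReal (Real.exp (U ω + V ω)) ≤
      2⁻¹ * (ENNReal.ofReal (Real.exp (2 * U ω)) + ENNReal.ofReal (Real.exp (2 * V ω))) := by
    intro ω
    rw [← ENNReal.ofReal_add (Real.exp_pos _).le (Real.exp_pos _).le,
      show (2⁻¹ : ℝ≥0∞) = ENNReal.ofReal 2⁻¹ by rw [ENNReal.ofReal_inv_of_pos two_pos]; simp,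
      ← ENNReal.ofReal_mul (by norm_num)]
    refine ENNReal.ofReal_le_ofReal ?_
    have e1 : Real.exp (2 * U ω) = Real.exp (U ω) ^ 2 := by rw [← Real.exp_nat_mul]; simp
    have e2 : Real.exp (2 * V ω) = Real.exp (V ω) ^ 2 := by rw [← Real.exp_nat_mul]; simp
    rw [Real.exp_add, e1, e2]
    nlinarith [sq_nonneg (Real.exp (U ω) - Real.exp (V ω))]
  calc _ ≤ ∫⁻ ω, 2⁻¹ * (ENNReal.ofReal (Real.exp (2 * U ω))
        + ENNReal.ofReal (Real.exp (2 * V ω))) ∂P := lintegral_mono hle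
    _ = 2⁻¹ * (∫⁻ ω, ENNReal.ofReal (Real.exp (2 * U ω)) ∂P
        + ∫⁻ ω, ENNReal.ofReal (Real.exp (2 * V ω)) ∂P) := by
      rw [lintegral_const_mul _ (by fun_prop), lintegral_add_left (by fun_prop)]
    _ ≤ 2⁻¹ * (q + q) := by gcongr
    _ = q := by rw [← two_mul, ← mul_assoc, ENNReal.inv_mul_cancel (by simp) (by simp), one_mul]

/-- The integral equals `(1 - 2t) ^ (-1/2)` with `t = b * v`. After squaring, the claim follows from
`(1 + 4t)(1 - 2t) ≥ 1`, which holds exactly because `0 ≤ t ≤ 1/4`. -/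
theorem lintegral_exp_mul_sq_gaussianReal_le (v : NNReal) {b : ℝ} (hb : 0 ≤ b)
    (hbv : b * v ≤ 1 / 4) :
    ∫⁻ z, ENNReal.ofReal (Real.exp (b * z ^ 2)) ∂(gaussianReal 0 v)
      ≤ ENNReal.ofReal (Real.exp (2 * (b * v))) := by
  rcases eq_or_ne v 0 with rfl | hv
  · simp
  have hv0 : 0 < (v : ℝ) := NNReal.coe_pos.2 (pos_iff_ne_zero.2 hv)
  have hc : 0 < 1 / (2 * (v : ℝ)) - b := by
    rw [sub_pos, lt_div_iff₀ (by positivity)]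
    linarith
  rw [gaussianReal_of_var_ne_zero _ hv, lintegral_withDensity_eq_lintegral_mul _
    (measurable_gaussianPDF 0 v) (by fun_prop)]
  have e : ∀ z : ℝ, (gaussianPDF 0 v * fun z => ENNReal.ofReal (Real.exp (b * z ^ 2))) z
      = ENNReal.ofReal ((√(2 * Real.pi * v))⁻¹ * Real.exp (-(1 / (2 * (v : ℝ)) - b) * z ^ 2)) := by
    intro z
    rw [Pi.mul_apply, gaussianPDF, ← ENNReal.ofReal_mul (gaussianPDFReal_nonneg _ _ _),
      gaussianPDFReal, mul_assoc, ← Real.exp_add]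
    congr 3
    field_simp
    ring
  simp_rw [e]
  rw [← ofReal_integral_eq_lintegral_ofReal ((integrable_exp_neg_mul_sq hc).const_mul _)
    (Filter.Eventually.of_forall fun z => by positivity), integral_const_mul, integral_gaussian]
  refine ENNReal.ofReal_le_ofReal ?_
  rw [← Real.sqrt_inv, ← Real.sqrt_mul (by positivity), Real.sqrt_le_left (Real.exp_pos _).le,
    ← Real.exp_nat_mul]
  have hpi := Real.pi_pos
  have h1 : 0 < 1 - 2 * (b * v) := by linarith
  have e2 : (2 * Real.pi * (v : ℝ))⁻¹ * (Real.pi / (1 / (2 * (v : ℝ)) - b))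
      = 1 / (1 - 2 * (b * v)) := by
    have : 1 / (2 * (v : ℝ)) - b = (1 - 2 * (b * v)) / (2 * v) := by field_simp
    rw [this]
    field_simp
  rw [e2, div_le_iff₀ h1]
  have h2 := Real.add_one_le_exp ((2 : ℕ) * (2 * (b * (v : ℝ))))
  have h3 : 0 ≤ b * v := by positivity
  push_cast at h2 ⊢
  nlinarith

namespace DPClippedSGD

variable {d : ℕ} {σw : ℝ}

/-- The law `N(0, σw² I)` of the injected noise. -/
noncomputable abbrev noiseLaw (d : ℕ) (σw : ℝ) : Measure (EuclideanSpace ℝ (Fin d)) :=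
  multivariateGaussian 0 (σw ^ 2 • (1 : Matrix (Fin d) (Fin d) ℝ))

theorem posSemidef_noise : (σw ^ 2 • (1 : Matrix (Fin d) (Fin d) ℝ)).PosSemidef :=
  Matrix.PosSemidef.one.smul (sq_nonneg σw)

theorem lintegral_exp_inner_noiseLaw (u : EuclideanSpace ℝ (Fin d)) :
    ∫⁻ w, ENNReal.ofReal (Real.exp (inner ℝ u w)) ∂(noiseLaw d σw)
      = ENNReal.ofReal (Real.exp (σw ^ 2 * ‖u‖ ^ 2 / 2)) := by
  have hvar : Var[fun w => inner ℝ u w; noiseLaw d σw] = σw ^ 2 * ‖u‖ ^ 2 := by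
    rw [← covarianceBilin_self IsGaussian.memLp_two_id, covarianceBilin_multivariateGaussian
      posSemidef_noise, Matrix.smul_mulVec, Matrix.one_mulVec, dotProduct_smul, smul_eq_mul,
      EuclideanSpace.norm_sq_eq]
    simp [dotProduct, sq]
  have hmean : ∫ w, inner ℝ u w ∂(noiseLaw d σw) = 0 := by
    rw [integral_inner (𝕜 := ℝ) (f := fun w => w) IsGaussian.integrable_fun_id u,
      integral_id_multivariateGaussian]
    simp
  have hmap : (noiseLaw d σw).map (innerSL ℝ u)
      = gaussianReal 0 (σw ^ 2 * ‖u‖ ^ 2).toNNReal := by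
    rw [IsGaussian.map_eq_gaussianReal]
    congr 1
    rw [← hvar]
    rfl
  have h1 : ∫⁻ w, ENNReal.ofReal (Real.exp (inner ℝ u w)) ∂(noiseLaw d σw)
      = ∫⁻ z, ENNReal.ofReal (Real.exp z) ∂((noiseLaw d σw).map (innerSL ℝ u)) := by
    rw [lintegral_map (by fun_prop) (by fun_prop)]
    rfl
  have hi := integrable_exp_mul_gaussianReal (μ := 0) (v := (σw ^ 2 * ‖u‖ ^ 2).toNNReal) 1
  have hm := congrFun (mgf_fun_id_gaussianReal (μ := 0) (v := (σw ^ 2 * ‖u‖ ^ 2).toNNReal)) 1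
  simp only [one_mul] at hi
  simp only [mgf, one_mul] at hm
  rw [h1, hmap, ← ofReal_integral_eq_lintegral_ofReal hi
    (Filter.Eventually.of_forall fun z => (Real.exp_pos z).le), hm,
    Real.coe_toNNReal _ (by positivity)]
  simp

/-- Jensen's inequality with weights `1 / d` bounds `exp (b * ‖w‖ ^ 2)` by the average of `exp (b *
d * w i ^ 2)`, so only the one-dimensional marginals matter. -/
theorem lintegral_exp_norm_sq_noiseLaw_le {b : ℝ} (hd : 0 < d) (hb : 0 ≤ b)
    (hbd : b * d * σw ^ 2 ≤ 1 / 4) :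
    ∫⁻ w, ENNReal.ofReal (Real.exp (b * ‖w‖ ^ 2)) ∂(noiseLaw d σw)
      ≤ ENNReal.ofReal (Real.exp (2 * (b * d * σw ^ 2))) := by
  have hd' : (0 : ℝ) < d := by exact_mod_cast hd
  have hle : ∀ w : EuclideanSpace ℝ (Fin d), ENNReal.ofReal (Real.exp (b * ‖w‖ ^ 2))
      ≤ ∑ i, ENNReal.ofReal (1 / d) * ENNReal.ofReal (Real.exp (b * d * w i ^ 2)) := by
    intro w
    have := convexOn_exp.map_sum_le (t := Finset.univ) (w := fun _ : Fin d => 1 / (d : ℝ))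
      (p := fun i => b * d * w i ^ 2) (fun _ _ => by positivity)
      (by simp [hd'.ne']) (fun _ _ => Set.mem_univ _)
    simp only [smul_eq_mul] at this
    have e : ∑ i, 1 / (d : ℝ) * (b * d * w i ^ 2) = b * ‖w‖ ^ 2 := by
      rw [EuclideanSpace.norm_sq_eq, Finset.mul_sum]
      refine Finset.sum_congr rfl fun i _ => ?_
      rw [Real.norm_eq_abs, sq_abs]
      field_simp
    rw [e] at this
    refine (ENNReal.ofReal_le_ofReal this).trans_eq ?_
    rw [ENNReal.ofReal_sum_of_nonneg fun _ _ => by positivity]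
    exact Finset.sum_congr rfl fun i _ => ENNReal.ofReal_mul (by positivity)
  have hi : ∀ i : Fin d, ∫⁻ w, ENNReal.ofReal (Real.exp (b * d * w i ^ 2)) ∂(noiseLaw d σw)
      ≤ ENNReal.ofReal (Real.exp (2 * (b * d * σw ^ 2))) := by
    intro i
    have hmp := measurePreserving_eval_multivariateGaussian (μ := 0)
      (posSemidef_noise (d := d) (σw := σw)) (i := i)
    have hS : (((σw ^ 2 • (1 : Matrix (Fin d) (Fin d) ℝ)) i i).toNNReal : ℝ) = σw ^ 2 := by
      rw [Real.coe_toNNReal _ (by simp; positivity)]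
      simp
    rw [hmp.lintegral_comp (f := fun z => ENNReal.ofReal (Real.exp (b * d * z ^ 2))) (by fun_prop)]
    have := lintegral_exp_mul_sq_gaussianReal_le
      ((σw ^ 2 • (1 : Matrix (Fin d) (Fin d) ℝ)) i i).toNNReal (b := b * d) (by positivity)
      (by rwa [hS])
    rw [hS] at this
    exact this
  calc _ ≤ ∫⁻ w : EuclideanSpace ℝ (Fin d),
        ∑ i, ENNReal.ofReal (1 / d) * ENNReal.ofReal (Real.exp (b * d * w i ^ 2))
          ∂(noiseLaw d σw) := lintegral_mono hle
    _ = ∑ i, ENNReal.ofReal (1 / d) *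
        ∫⁻ w, ENNReal.ofReal (Real.exp (b * d * w i ^ 2)) ∂(noiseLaw d σw) := by
      rw [lintegral_finsetSum _ fun i _ => by fun_prop]
      exact Finset.sum_congr rfl fun i _ => lintegral_const_mul _ (by fun_prop)
    _ ≤ ∑ _i : Fin d, ENNReal.ofReal (1 / d) *
        ENNReal.ofReal (Real.exp (2 * (b * d * σw ^ 2))) := by
      gcongr with i
      exact hi i
    _ = _ := by
      rw [Finset.sum_const, Finset.card_univ, Fintype.card_fin, nsmul_eq_mul, ← mul_assoc,
        ← ENNReal.ofReal_natCast, ← ENNReal.ofReal_mul (by positivity), mul_one_div_cancel hd'.ne',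
        ENNReal.ofReal_one, one_mul]

theorem TunedStepsize.lintegral_exp_noiseError_le {K A s L r lam γ : ℝ}
    {G : EuclideanSpace ℝ (Fin d)}
    (h : TunedStepsize d K A s L r lam σw γ) (hd : 0 < d) (hGL : ‖G‖ ≤ 2 * (L * r)) :
    ∫⁻ w, ENNReal.ofReal (Real.exp (4 * A / (L * r ^ 2) *
      (-γ * inner ℝ G w + 10000 * L * γ ^ 2 * ‖w‖ ^ 2))) ∂(noiseLaw d σw)
      ≤ ENNReal.ofReal (Real.exp (A / K)) := by
  have hL := h.L_pos
  have hγ := h.γ_pos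
  have hr := h.r_pos
  have hA := h.A_pos
  have hK : 0 < K := zero_lt_one.trans_le h.one_le_K
  have hd' : (1 : ℝ) ≤ d := by exact_mod_cast hd
  have hnoise : γ ^ 2 * σw ^ 2 * d * A ≤ r ^ 2 / 360000 / K := by
    rw [le_div_iff₀ hK]; linarith [h.noise]
  set τ := 4 * A / (L * r ^ 2) with hτ
  have hτ0 : 0 < τ := by positivity
  simp_rw [mul_add]
  refine lintegral_exp_add_le (by fun_prop) (by fun_prop) ?_ ?_
  · have e : ∀ w, 2 * (τ * (-γ * inner ℝ G w)) = inner ℝ ((-(2 * τ * γ)) • G) w := fun w => by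
      rw [real_inner_smul_left]; ring
    simp_rw [e]
    rw [lintegral_exp_inner_noiseLaw]
    refine ENNReal.ofReal_le_ofReal (Real.exp_le_exp.2 ?_)
    rw [norm_smul, norm_neg, Real.norm_of_nonneg (by positivity)]
    calc σw ^ 2 * (2 * τ * γ * ‖G‖) ^ 2 / 2 ≤ σw ^ 2 * (2 * τ * γ * (2 * (L * r))) ^ 2 / 2 := by
          gcongr
      _ = 128 * A / r ^ 2 * (γ ^ 2 * σw ^ 2 * 1 * A) := by rw [hτ]; field_simp; ring
      _ ≤ 128 * A / r ^ 2 * (γ ^ 2 * σw ^ 2 * d * A) := by gcongr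
      _ ≤ 128 * A / r ^ 2 * (r ^ 2 / 360000 / K) := by gcongr
      _ = A / K * (128 / 360000) := by field_simp
      _ ≤ A / K := mul_le_of_le_one_right (by positivity) (by norm_num)
  -- The ratio `80000 / 360000 = 2/9` is below the threshold `1/4` of the Gaussian integral, and
  -- twice it is below `1/2 ≤ A`.
  · have hb : 2 * τ * (10000 * L * γ ^ 2) * d * σw ^ 2 ≤ 80000 / 360000 / K := by
      calc _ = 80000 / r ^ 2 * (γ ^ 2 * σw ^ 2 * d * A) := by rw [hτ]; field_simp; ring
        _ ≤ 80000 / r ^ 2 * (r ^ 2 / 360000 / K) := by gcongr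
        _ = _ := by field_simp
    have hK1 : 80000 / 360000 / K ≤ 80000 / 360000 := div_le_self (by norm_num) h.one_le_K
    have e : ∀ w : EuclideanSpace ℝ (Fin d), 2 * (τ * (10000 * L * γ ^ 2 * ‖w‖ ^ 2))
        = 2 * τ * (10000 * L * γ ^ 2) * ‖w‖ ^ 2 := fun w => by ring
    simp_rw [e]
    refine (lintegral_exp_norm_sq_noiseLaw_le hd (by positivity) (by linarith)).trans ?_
    refine ENNReal.ofReal_le_ofReal (Real.exp_le_exp.2 ?_)
    refine (mul_le_mul_of_nonneg_left hb two_pos.le).trans ?_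
    rw [← mul_div_assoc]
    gcongr
    linarith [h.half_le_A]

end DPClippedSGD

/-! ### Random recursions with independent inputs. -/

/-- If `h` grows by at most a factor `q` on average in one step of a random recursion that is driven
by independent variables, then it grows by at most `q ^ n` in `n` steps. -/
theorem lintegral_random_recursion_le {S E Ω : Type*} [MeasurableSpace S] [MeasurableSpace E]
    [MeasurableSpace Ω] {P : Measure Ω} [IsProbabilityMeasure P] {Ψ : S × E → S}
    (hΨ : Measurable Ψ) {η : ℕ → Ω → E} (hη : ∀ k, Measurable (η k)) (hind : iIndepFun η P)
    {h : S → ℝ≥0∞} (hh : Measurable h) {q : ℝ≥0∞}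
    (hstep : ∀ k s, ∫⁻ ω, h (Ψ (s, η k ω)) ∂P ≤ q * h s) {X : ℕ → Ω → S} {s₀ : S}
    (hX0 : ∀ ω, X 0 ω = s₀) (hX : ∀ k ω, X (k + 1) ω = Ψ (X k ω, η k ω)) (n : ℕ) :
    ∫⁻ ω, h (X n ω) ∂P ≤ q ^ n * h s₀ := by
  -- The state at time `n` depends only on the inputs before `n`, hence is independent of input `n`;
  -- Fubini's theorem then applies the one-step bound.
  have hfac : ∀ n, ∃ φ : (Finset.range n → E) → S, Measurable φ ∧
      ∀ ω, X n ω = φ (fun j => η j ω) := by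
    intro n
    induction n with
    | zero => exact ⟨fun _ => s₀, measurable_const, hX0⟩
    | succ n ih =>
      obtain ⟨φ, hφ, hφX⟩ := ih
      refine ⟨fun y => Ψ (φ (fun j => y ⟨j, Finset.mem_range.2
          ((Finset.mem_range.1 j.2).trans (Nat.lt_succ_self n))⟩),
          y ⟨n, Finset.self_mem_range_succ n⟩), ?_, fun ω => by rw [hX, hφX]⟩
      refine hΨ.comp ((hφ.comp (measurable_pi_lambda _ fun j => ?_)).prodMk ?_)
      · exact measurable_pi_apply _
      · exact measurable_pi_apply _
  have hmeas : ∀ n, Measurable (X n) := by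
    intro n
    obtain ⟨φ, hφ, hφX⟩ := hfac n
    rw [funext hφX]
    exact hφ.comp (measurable_pi_lambda _ fun j => hη j)
  have hindep : ∀ n, IndepFun (X n) (η n) P := by
    intro n
    obtain ⟨φ, hφ, hφX⟩ := hfac n
    have := hind.indepFun_finset (Finset.range n) {n} (by simp) hη
    have h2 := this.comp hφ (measurable_pi_apply (⟨n, by simp⟩ : ({n} : Finset ℕ)))
    rw [funext hφX]
    exact h2
  induction n with
  | zero => simp [hX0]
  | succ n ih =>
    have hm : Measurable fun p : S × E => h (Ψ p) := hh.comp hΨ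
    calc ∫⁻ ω, h (X (n + 1) ω) ∂P = ∫⁻ ω, h (Ψ (X n ω, η n ω)) ∂P := by simp_rw [hX]
      _ = ∫⁻ p, h (Ψ p) ∂(P.map fun ω => (X n ω, η n ω)) :=
        (lintegral_map hm ((hmeas n).prodMk (hη n))).symm
      _ = ∫⁻ s, ∫⁻ e, h (Ψ (s, e)) ∂(P.map (η n)) ∂(P.map (X n)) := by
        have := Measure.isProbabilityMeasure_map (μ := P) (hη n).aemeasurable
        have := Measure.isProbabilityMeasure_map (μ := P) (hmeas n).aemeasurable
        rw [(hindep n).map_prod_eq_prod_map_map (hmeas n).aemeasurable (hη n).aemeasurable,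
          lintegral_prod _ hm.aemeasurable]
      _ ≤ ∫⁻ s, q * h s ∂(P.map (X n)) := by
        refine lintegral_mono fun s => ?_
        exact (lintegral_map (hm.comp measurable_prodMk_left) (hη n)).trans_le (hstep n s)
      _ = q * ∫⁻ ω, h (X n ω) ∂P := by
        rw [lintegral_const_mul _ hh, lintegral_map hh (hmeas n)]
      _ ≤ q * (q ^ n * h s₀) := by gcongr
      _ = q ^ (n + 1) * h s₀ := by rw [pow_succ']; ring

/-! ### The error process and the deterministic trajectory bound. -/

namespace DPClippedSGD

variable {d : ℕ} {f : EuclideanSpace ℝ (Fin d) → ℝ} {fstar L Δ γ lam σw α K A s : ℝ}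

/-- The error, relative to the noiseless descent inequality, of the step from `x` along the sampled
gradient `g` and the noise `w`. Its last term overestimates the second-order effect of the noise, so
that a step with large noise is recorded as a large error. -/
noncomputable def stepError (f : EuclideanSpace ℝ (Fin d) → ℝ) (L γ lam : ℝ)
    (x g w : EuclideanSpace ℝ (Fin d)) : ℝ :=
  (-γ * inner ℝ (∇ f x) (clip lam g - ∇ f x) + 2 * L * γ ^ 2 * ‖clip lam g - ∇ f x‖ ^ 2)
    + (-γ * inner ℝ (∇ f x) w + 10000 * L * γ ^ 2 * ‖w‖ ^ 2)

theorem TunedStepsize.le_sub_add_stepError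
    (h : TunedStepsize d K A s L √(Δ / L) lam σw γ) (hΔ : 0 < Δ)
    (hf : SmoothOn f L (region f fstar L Δ)) {x : EuclideanSpace ℝ (Fin d)}
    (hx : x ∈ sublevel f fstar Δ) (g : EuclideanSpace ℝ (Fin d)) {w : EuclideanSpace ℝ (Fin d)}
    (hw : γ * ‖w‖ ≤ √(Δ / L) / 40) :
    f (x - γ • (clip lam g + w)) ≤ f x - γ / 2 * ‖∇ f x‖ ^ 2 + stepError f L γ lam x g w := by
  have hγ := h.γ_pos
  have hL := h.L_pos
  have hv : ‖-(γ • (clip lam g + w))‖ ≤ √(Δ / L) / 20 := by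
    rw [norm_neg, norm_smul, Real.norm_of_nonneg hγ.le]
    have h1 := mul_le_mul_of_nonneg_left (norm_add_le (clip lam g) w) hγ.le
    have h2 := mul_le_mul_of_nonneg_left (norm_clip_le h.lam_pos g) hγ.le
    have h3 := h.γ_mul_lam_le
    linarith
  have hdesc := descent_step hL hΔ hf hx hv
  rw [← sub_eq_add_neg] at hdesc
  set G := ∇ f x with hG
  set X := clip lam g - G with hX
  have hc : clip lam g + w = G + X + w := by rw [hX]; abel
  have hn : ‖G + X + w‖ ^ 2 ≤ 3 * (‖G‖ ^ 2 + ‖X‖ ^ 2 + ‖w‖ ^ 2) := by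
    have h1 : ‖G + X + w‖ ≤ ‖G‖ + ‖X‖ + ‖w‖ := norm_add₃_le
    have h2 : ‖G + X + w‖ ^ 2 ≤ (‖G‖ + ‖X‖ + ‖w‖) ^ 2 := by gcongr
    nlinarith [sq_nonneg (‖G‖ - ‖X‖), sq_nonneg (‖G‖ - ‖w‖), sq_nonneg (‖X‖ - ‖w‖)]
  have hi : inner ℝ G (-(γ • (clip lam g + w)))
      = -γ * ‖G‖ ^ 2 + -γ * inner ℝ G X + -γ * inner ℝ G w := by
    rw [hc, inner_neg_right, inner_smul_right, inner_add_right, inner_add_right,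
      real_inner_self_eq_norm_sq]
    ring
  rw [hi, norm_neg, norm_smul, Real.norm_of_nonneg hγ.le, mul_pow, hc] at hdesc
  have hq : L / 2 * (γ ^ 2 * ‖G + X + w‖ ^ 2)
      ≤ L / 2 * (γ ^ 2 * (3 * (‖G‖ ^ 2 + ‖X‖ ^ 2 + ‖w‖ ^ 2))) := by gcongr
  have hG2 : γ * L * (γ * ‖G‖ ^ 2) ≤ 1 / 600 * (γ * ‖G‖ ^ 2) :=
    mul_le_mul_of_nonneg_right h.smoothness (by positivity)
  have p1 : 0 ≤ γ * ‖G‖ ^ 2 := by positivity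
  have p2 : 0 ≤ L * γ ^ 2 * ‖X‖ ^ 2 := by positivity
  have p3 : 0 ≤ L * γ ^ 2 * ‖w‖ ^ 2 := by positivity
  rw [hc]
  simp only [stepError, ← hG, ← hX]
  linarith

theorem sqrt_mul_sqrt_div (hL : 0 < L) (hΔ : 0 < Δ) : √(L * Δ) * √(Δ / L) = Δ := by
  rw [← Real.sqrt_mul (by positivity), show L * Δ * (Δ / L) = Δ * Δ by field_simp,
    Real.sqrt_mul_self hΔ.le]

theorem mul_sqrt_div (hL : 0 < L) (hΔ : 0 < Δ) : L * √(Δ / L) = √(L * Δ) := by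
  rw [show L * Δ = L ^ 2 * (Δ / L) by field_simp, Real.sqrt_mul (by positivity),
    Real.sqrt_sq hL.le]

theorem mul_sqrt_div_sq (hL : 0 < L) (hΔ : 0 < Δ) : L * √(Δ / L) ^ 2 = Δ := by
  rw [Real.sq_sqrt (by positivity)]
  field_simp

/-- With `v = γ * ‖w‖ > r / 40`, the inflated term `10000 * L * v ^ 2` exceeds the largest possible
negative contributions, `L * r ^ 2` from sampling and `2 * L * r * v` from the linear noise term, by
at least `2 * L * r ^ 2 = 2 * Δ`. -/
theorem TunedStepsize.le_stepError (h : TunedStepsize d K A s L √(Δ / L) lam σw γ) (hΔ : 0 < Δ)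
    {x g w : EuclideanSpace ℝ (Fin d)} (hG : ‖∇ f x‖ ≤ 2 * (L * √(Δ / L))) (hGl : ‖∇ f x‖ ≤ lam)
    (hw : √(Δ / L) / 40 < γ * ‖w‖) : 2 * Δ ≤ stepError f L γ lam x g w := by
  have hγ := h.γ_pos
  have hL := h.L_pos
  have hr := h.r_pos
  have hY := (abs_le.1 (h.abs_sampleError_le (v := g) hG hGl)).1
  have hX := mul_le_mul_of_nonneg_left (norm_clip_sub_le (v := g) h.lam_pos hGl) hγ.le
  have hw1 : inner ℝ (∇ f x) w ≤ 2 * (L * √(Δ / L)) * ‖w‖ :=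
    (real_inner_le_norm _ _).trans (by gcongr)
  have hΔr := mul_sqrt_div_sq hL hΔ
  unfold stepError
  set r := √(Δ / L)
  set v := γ * ‖w‖ with hv
  set X := ‖clip lam g - ∇ f x‖
  have h1 : 4 * γ * L * r * X ≤ L * r ^ 2 := by
    have : γ * X ≤ r / 20 := by linarith [h.γ_mul_lam_le]
    nlinarith [mul_le_mul_of_nonneg_left this (mul_pos hL hr).le, mul_pos hL (pow_pos hr 2)]
  have h2 : γ * inner ℝ (∇ f x) w ≤ 2 * L * r * v := by
    have := mul_le_mul_of_nonneg_left hw1 hγ.le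
    rw [hv]; linarith
  have h3 : 10000 * L * γ ^ 2 * ‖w‖ ^ 2 = L * (10000 * v ^ 2) := by rw [hv]; ring
  have h4 : 3 * r ^ 2 + 2 * r * v ≤ 10000 * v ^ 2 := by nlinarith
  have h5 := mul_le_mul_of_nonneg_left h4 hL.le
  linarith

/-- The iterates together with the accumulated error, which is frozen once it reaches `Δ` or the
iterate leaves the sublevel set. The drift `u` maps an iterate and a sample to a gradient. -/
noncomputable def trackedStep {Ξ : Type*} (f : EuclideanSpace ℝ (Fin d) → ℝ)
    (u : Ξ × EuclideanSpace ℝ (Fin d) → EuclideanSpace ℝ (Fin d)) (fstar L Δ γ lam : ℝ) :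
    (EuclideanSpace ℝ (Fin d) × ℝ) × (Ξ × EuclideanSpace ℝ (Fin d)) →
      EuclideanSpace ℝ (Fin d) × ℝ := fun p =>
  (p.1.1 - γ • (clip lam (u (p.2.1, p.1.1)) + p.2.2),
    open Classical in
    if p.1.2 < Δ ∧ p.1.1 ∈ sublevel f fstar Δ then
      p.1.2 + stepError f L γ lam p.1.1 (u (p.2.1, p.1.1)) p.2.2 else p.1.2)

theorem measurable_trackedStep {Ξ : Type*} [MeasurableSpace Ξ]
    {u : Ξ × EuclideanSpace ℝ (Fin d) → EuclideanSpace ℝ (Fin d)} (hu : Measurable u)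
    (hS : MeasurableSet (sublevel f fstar Δ)) :
    Measurable (trackedStep f u fstar L Δ γ lam) := by
  have hc := measurable_clip (d := d) (lam := lam)
  have hg := measurable_gradient f
  unfold trackedStep stepError
  refine Measurable.prodMk (by fun_prop) (Measurable.ite ?_ (by fun_prop) (by fun_prop))
  exact (measurableSet_lt measurable_fst.snd measurable_const).inter
    (measurable_fst.fst hS)

/-- Along a trajectory whose accumulated error stays below `Δ`, the objective and the squared
gradient norms are controlled by the accumulated error. -/
theorem TunedStepsize.trajectory_bound (h : TunedStepsize d K A s L √(Δ / L) lam σw γ)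
    (hΔ : 0 < Δ) (hf : SmoothOn f L (region f fstar L Δ))
    (hinf : ∀ y ∈ region f fstar L Δ, fstar ≤ f y)
    (hlam : ∀ x ∈ sublevel f fstar Δ, ‖∇ f x‖ ≤ lam) {Ξ : Type*}
    {u : Ξ × EuclideanSpace ℝ (Fin d) → EuclideanSpace ℝ (Fin d)}
    {X : ℕ → EuclideanSpace ℝ (Fin d) × ℝ} {e : ℕ → Ξ × EuclideanSpace ℝ (Fin d)}
    (hX : ∀ k, X (k + 1) = trackedStep f u fstar L Δ γ lam (X k, e k)) (hX0 : (X 0).2 = 0)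
    (hx0 : f (X 0).1 - fstar ≤ Δ) {n : ℕ} (hn : (X n).2 < Δ) :
    ∀ k ≤ n, (X k).1 ∈ sublevel f fstar Δ ∧
      f (X k).1 + γ / 2 * ∑ j ∈ Finset.range k, ‖∇ f (X j).1‖ ^ 2 ≤ f (X 0).1 + (X k).2 := by
  have hL := h.L_pos
  have hγ := h.γ_pos
  -- The error is frozen once it reaches `Δ`, so being below `Δ` at time `n` forces the same at all
  -- earlier times.
  have hV : ∀ k ≤ n, (X k).2 < Δ := by
    by_contra! hcon
    obtain ⟨k, hk, hVk⟩ := hcon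
    have : ∀ j, Δ ≤ (X (k + j)).2 := by
      intro j
      induction j with
      | zero => exact hVk
      | succ j ih =>
        rw [← add_assoc, hX]
        simp only [trackedStep]
        rwa [if_neg fun hc => absurd hc.1 (not_lt.2 ih)]
    have := this (n - k)
    rw [Nat.add_sub_cancel' hk] at this
    linarith
  intro k
  induction k with
  | zero =>
    intro _
    refine ⟨?_, by simp [hX0]⟩
    change f (X 0).1 ≤ fstar + 2 * Δ
    linarith
  | succ k ih =>
    intro hk
    obtain ⟨hmem, hbd⟩ := ih (by omega)
    have hVk := hV k (by omega)
    have hVk1 := hV (k + 1) hk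
    have hreg := hinf _ (sublevel_subset_region hL hΔ hmem)
    have hsum : 0 ≤ γ / 2 * ∑ j ∈ Finset.range k, ‖∇ f (X j).1‖ ^ 2 := by positivity
    have e1 : (X (k + 1)).1 = (X k).1 - γ • (clip lam (u ((e k).1, (X k).1)) + (e k).2) := by
      rw [hX]; rfl
    have e2 : (X (k + 1)).2 = (X k).2 +
        stepError f L γ lam (X k).1 (u ((e k).1, (X k).1)) (e k).2 := by
      rw [hX]
      simp only [trackedStep]
      rw [if_pos ⟨hVk, hmem⟩]
    -- Since `f ≥ f*` on `Q`, the bound at time `k` gives accumulated error at least `-Δ`. A large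
    -- noise vector would add `2 * Δ` and push it to `Δ`.
    have hsmall : γ * ‖(e k).2‖ ≤ √(Δ / L) / 40 := by
      by_contra! hlarge
      have hgl := norm_gradient_le hL hΔ hf hinf hmem
      rw [← mul_sqrt_div hL hΔ] at hgl
      have := h.le_stepError (f := f) (g := u ((e k).1, (X k).1)) hΔ hgl (hlam _ hmem) hlarge
      linarith
    have hstep := h.le_sub_add_stepError hΔ hf hmem (u ((e k).1, (X k).1)) hsmall
    rw [← e1] at hstep
    have hbd' : f (X (k + 1)).1 + γ / 2 * ∑ j ∈ Finset.range (k + 1), ‖∇ f (X j).1‖ ^ 2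
        ≤ f (X 0).1 + (X (k + 1)).2 := by
      rw [Finset.sum_range_succ, e2]
      linarith
    refine ⟨?_, hbd'⟩
    have : 0 ≤ γ / 2 * ∑ j ∈ Finset.range (k + 1), ‖∇ f (X j).1‖ ^ 2 := by positivity
    change f (X (k + 1)).1 ≤ fstar + 2 * Δ
    linarith

/-! ### The high-probability gradient bound. -/

section Probability

variable {Ξ Ω : Type*} [MeasurableSpace Ξ] [MeasurableSpace Ω] {D : Measure Ξ}
  [IsProbabilityMeasure D] {F : Ξ → EuclideanSpace ℝ (Fin d) → ℝ} {P : Measure Ω}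
  {ξ : ℕ → Ω → Ξ} {w : ℕ → Ω → EuclideanSpace ℝ (Fin d)}

theorem TunedStepsize.lintegral_exp_stepError_le (hd : 0 < d) (hα : 1 < α) (hα2 : α ≤ 2)
    {σ : ℝ} {Q : Set (EuclideanSpace ℝ (Fin d))}
    (h : TunedStepsize d K A s L √(Δ / L) lam σw γ)
    (hF : StochasticObjective D F) (hO : HeavyTailedOracleOn D F α σ Q)
    (hS : FreshSamples P D σw ξ w) (hσ : σ ^ α ≤ s * lam ^ α)
    {x : EuclideanSpace ℝ (Fin d)} (hx : x ∈ Q)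
    (hG : ‖∇ (expectedLoss D F) x‖ ≤ 2 * lam / 3)
    (hGL : ‖∇ (expectedLoss D F) x‖ ≤ 2 * (L * √(Δ / L))) (k : ℕ) :
    ∫⁻ ω, ENNReal.ofReal (Real.exp (2 * A / (L * √(Δ / L) ^ 2) *
      stepError (expectedLoss D F) L γ lam x (∇ (F (ξ k ω)) x) (w k ω))) ∂P
      ≤ ENNReal.ofReal (Real.exp (A / K)) := by
  have hgm : Measurable fun i => ∇ (F i) x := hF.measurable_gradient.comp measurable_prodMk_right
  have hξ := hS.measurable_sample k
  have hgξ : Measurable fun ω => ∇ (F (ξ k ω)) x := hgm.comp hξ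
  have hw := hS.measurable_noise k
  have hc := measurable_clip (d := d) (lam := lam)
  unfold stepError
  simp_rw [mul_add (2 * A / (L * √(Δ / L) ^ 2))]
  refine lintegral_exp_add_le (by fun_prop) (by fun_prop) ?_ ?_
  · have := h.lintegral_exp_sampleError_le (hO.integrable x hx) (hO.unbiased x hx) hgm
      (hO.integrable_moment x hx) ((hO.moment_le x hx).trans hσ) hα hα2 hG hGL
    rw [← hS.law_sample k, lintegral_map (by fun_prop) hξ, hS.law_sample k] at this
    refine (lintegral_congr fun ω => ?_).trans_le this
    congr 2
    ring
  · have := h.lintegral_exp_noiseError_le hd hGL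
    rw [noiseLaw, ← hS.law_noise k, lintegral_map (by fun_prop) hw] at this
    refine (lintegral_congr fun ω => ?_).trans_le this
    congr 2
    ring

/-- With probability at least `1 - exp (-A)` the best squared gradient norm of the first `n`
iterates is at most `4 Δ / (γ n)`. -/
theorem TunedStepsize.prob_min_gradient_le [IsProbabilityMeasure P] {n : ℕ} (hd : 0 < d) (hα : 1 < α) (hα2 : α ≤ 2)
    {σ : ℝ} (hΔ : 0 < Δ) (h : TunedStepsize d n A s L √(Δ / L) lam σw γ)
    (hF : StochasticObjective D F)
    (hinf : ∀ y ∈ region (expectedLoss D F) fstar L Δ, fstar ≤ expectedLoss D F y)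
    (hf : SmoothOn (expectedLoss D F) L (region (expectedLoss D F) fstar L Δ))
    (hO : HeavyTailedOracleOn D F α σ (region (expectedLoss D F) fstar L Δ))
    (hS : FreshSamples P D σw ξ w) (hσ : σ ^ α ≤ s * lam ^ α) (hlam : 3 * √(L * Δ) ≤ lam)
    {x₀ : EuclideanSpace ℝ (Fin d)} (hx₀ : expectedLoss D F x₀ - fstar ≤ Δ) :
    1 - ENNReal.ofReal (Real.exp (-A)) ≤ P {ω | (⨅ t : Fin (n + 1),
        ‖∇ (expectedLoss D F) (iterate F γ lam x₀ (fun k => ξ k ω) (fun k => w k ω) t)‖ ^ 2)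
          ≤ 4 * Δ / (γ * n)} := by
  set f := expectedLoss D F with hfdef
  have hL := h.L_pos
  have hγ := h.γ_pos
  have hn : (0 : ℝ) < n := zero_lt_one.trans_le h.one_le_K
  have hA := h.A_pos
  have hgrad := fun x (hx : x ∈ sublevel f fstar Δ) => norm_gradient_le hL hΔ hf hinf hx
  let u : Ξ × EuclideanSpace ℝ (Fin d) → EuclideanSpace ℝ (Fin d) := fun p => ∇ (F p.1) p.2
  let η : ℕ → Ω → Ξ × EuclideanSpace ℝ (Fin d) := fun k ω => (ξ k ω, w k ω)
  let X : ℕ → Ω → EuclideanSpace ℝ (Fin d) × ℝ := fun k ω =>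
    Nat.rec (x₀, 0) (fun k y => trackedStep f u fstar L Δ γ lam (y, η k ω)) k
  have hXit : ∀ k ω, (X k ω).1 = iterate F γ lam x₀ (fun k => ξ k ω) (fun k => w k ω) k := by
    intro k ω
    induction k with
    | zero => rfl
    | succ k ih =>
      rw [iterate, ← ih]
      rfl
  have hηm : ∀ k, Measurable (η k) := fun k =>
    (hS.measurable_sample k).prodMk (hS.measurable_noise k)
  have hΨ : Measurable (trackedStep f u fstar L Δ γ lam) :=
    measurable_trackedStep hF.measurable_gradient (isClosed_sublevel hL hΔ hf).measurableSet
  have hXm : ∀ k, Measurable (X k) := by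
    intro k
    induction k with
    | zero => exact measurable_const
    | succ k ih => exact hΨ.comp (ih.prodMk (hηm k))
  have hΔr := mul_sqrt_div_sq hL hΔ
  have hq1 : 1 ≤ ENNReal.ofReal (Real.exp (A / n)) :=
    ENNReal.one_le_ofReal.2 (Real.one_le_exp (by positivity))
  have hrec := lintegral_random_recursion_le (P := P) hΨ hηm hS.indep_steps
    (h := fun p => ENNReal.ofReal (Real.exp (2 * A / Δ * p.2))) (by fun_prop)
    (q := ENNReal.ofReal (Real.exp (A / n))) ?_ (X := X) (s₀ := (x₀, 0)) (fun _ => rfl)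
    (fun _ _ => rfl) n
  swap
  -- Active states use the one-step exponential bound; frozen states keep their value, for which `q
  -- ≥ 1` suffices.
  · rintro k ⟨x, V⟩
    by_cases hact : V < Δ ∧ x ∈ sublevel f fstar Δ
    · have hx := hact.2
      have hg := hgrad x hx
      have := h.lintegral_exp_stepError_le hd hα hα2 hF hO hS hσ
        (sublevel_subset_region hL hΔ hx) (by linarith)
        (by rwa [mul_sqrt_div hL hΔ]) k
      rw [hΔr] at this
      simp only [trackedStep, if_pos hact]
      simp_rw [mul_add, Real.exp_add, ENNReal.ofReal_mul (Real.exp_pos _).le]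
      rw [lintegral_const_mul' _ _ ENNReal.ofReal_ne_top, mul_comm]
      gcongr
    · simp only [trackedStep, if_neg hact, lintegral_const, measure_univ, mul_one]
      exact le_mul_of_one_le_left zero_le hq1
  -- Markov's inequality at level `exp (2 * A)` against the mean bound `exp (A / n) ^ n = exp A`.
  have hbad : P {ω | Δ ≤ (X n ω).2} ≤ ENNReal.ofReal (Real.exp (-A)) := by
    have hmark := mul_meas_ge_le_lintegral₀ (μ := P)
      (f := fun ω => ENNReal.ofReal (Real.exp (2 * A / Δ * (X n ω).2)))
      (by have := hXm n; fun_prop) (ENNReal.ofReal (Real.exp (2 * A)))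
    have hsub : {ω | Δ ≤ (X n ω).2} ⊆ {ω | ENNReal.ofReal (Real.exp (2 * A)) ≤
        ENNReal.ofReal (Real.exp (2 * A / Δ * (X n ω).2))} := by
      intro ω hω
      refine ENNReal.ofReal_le_ofReal (Real.exp_le_exp.2 ?_)
      calc 2 * A = 2 * A / Δ * Δ := by field_simp
        _ ≤ _ := by gcongr; exact hω
    have hpow : ENNReal.ofReal (Real.exp (A / n)) ^ n = ENNReal.ofReal (Real.exp A) := by
      rw [← ENNReal.ofReal_pow (Real.exp_pos _).le, ← Real.exp_nat_mul]
      congr 2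
      field_simp
    simp only [mul_zero, Real.exp_zero, ENNReal.ofReal_one, mul_one, hpow] at hrec
    have h2 := (mul_le_mul_right (measure_mono (μ := P) hsub)
      (ENNReal.ofReal (Real.exp (2 * A)))).trans (hmark.trans hrec)
    calc P {ω | Δ ≤ (X n ω).2}
        = ENNReal.ofReal (Real.exp (-(2 * A))) *
          (ENNReal.ofReal (Real.exp (2 * A)) * P {ω | Δ ≤ (X n ω).2}) := by
          rw [← mul_assoc, ← ENNReal.ofReal_mul (Real.exp_pos _).le, ← Real.exp_add]
          simp
      _ ≤ ENNReal.ofReal (Real.exp (-(2 * A))) * ENNReal.ofReal (Real.exp A) := by gcongr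
      _ = ENNReal.ofReal (Real.exp (-A)) := by
          rw [← ENNReal.ofReal_mul (Real.exp_pos _).le, ← Real.exp_add]
          congr 2
          ring
  have hmeas : MeasurableSet {ω | Δ ≤ (X n ω).2} :=
    measurableSet_le measurable_const (hXm n).snd
  calc 1 - ENNReal.ofReal (Real.exp (-A)) ≤ 1 - P {ω | Δ ≤ (X n ω).2} := by gcongr
    _ = P {ω | Δ ≤ (X n ω).2}ᶜ := (prob_compl_eq_one_sub hmeas).symm
    _ ≤ _ := by
      refine measure_mono fun ω hω => ?_
      have hω' : (X n ω).2 < Δ := not_le.1 hω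
      have htr := (h.trajectory_bound hΔ hf hinf (fun x hx => (hgrad x hx).trans (by
        linarith [Real.sqrt_nonneg (L * Δ)])) (X := fun k => X k ω) (e := fun k => η k ω)
        (fun _ => rfl) rfl hx₀ hω') n le_rfl
      have hlow := hinf _ (sublevel_subset_region hL hΔ htr.1)
      have hbd := htr.2
      have hx0' : f (X 0 ω).1 - fstar ≤ Δ := hx₀
      have hmin : ∀ j ∈ Finset.range n, (⨅ t : Fin (n + 1),
          ‖∇ f (iterate F γ lam x₀ (fun k => ξ k ω) (fun k => w k ω) t)‖ ^ 2)
            ≤ ‖∇ f (X j ω).1‖ ^ 2 := by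
        intro j hj
        rw [hXit]
        exact ciInf_le (f := fun t : Fin (n + 1) =>
          ‖∇ f (iterate F γ lam x₀ (fun k => ξ k ω) (fun k => w k ω) t)‖ ^ 2)
          ⟨0, by rintro _ ⟨t, rfl⟩; positivity⟩
          ⟨j, (Finset.mem_range.1 hj).trans (Nat.lt_succ_self n)⟩
      have hsum := Finset.card_nsmul_le_sum _ _ _ hmin
      rw [Finset.card_range, nsmul_eq_mul] at hsum
      rw [Set.mem_ofPred_eq, le_div_iff₀ (by positivity)]
      -- The total budget is `2 * Δ`: the initial gap and the accumulated error are each at most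
      -- `Δ`.
      have := mul_le_mul_of_nonneg_left hsum (by positivity : 0 ≤ γ / 2)
      linarith

end Probability

end DPClippedSGD

/-! ### From the step-size rule to the four error terms. -/

namespace DPClippedSGD

theorem mul_le_of_ofReal_le_div {m a b : ℝ} (ha : 0 < a) (hm : 0 ≤ m)
    (h : ENNReal.ofReal m ≤ ENNReal.ofReal a / ENNReal.ofReal b) : m * b ≤ a := by
  rw [ENNReal.le_div_iff_mul_le (Or.inr (by simpa using ha)) (Or.inl ENNReal.ofReal_ne_top),
    ← ENNReal.ofReal_mul hm] at h
  exact (ENNReal.ofReal_le_ofReal_iff ha.le).1 h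

theorem mul_eq_of_ofReal_eq_div {m a b : ℝ} (hb : 0 ≤ b) (ha : 0 < a) (hm : 0 ≤ m)
    (h : ENNReal.ofReal m = ENNReal.ofReal a / ENNReal.ofReal b) : m * b = a := by
  refine le_antisymm (mul_le_of_ofReal_le_div ha hm h.le) ?_
  have h2 := ENNReal.div_le_iff_le_mul (a := ENNReal.ofReal a) (b := ENNReal.ofReal b)
    (c := ENNReal.ofReal m) (Or.inr ENNReal.ofReal_ne_top) (Or.inl ENNReal.ofReal_ne_top)
  have h3 := h2.1 h.ge
  rw [← ENNReal.ofReal_mul hm] at h3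
  exact (ENNReal.ofReal_le_ofReal_iff (by positivity)).1 h3

/-- The defining properties of a minimum of quotients in which a quotient with denominator `0` is
infinite. -/
theorem toReal_min_div_spec {x a₁ b₁ a₂ b₂ a₃ b₃ m : ℝ} (hx : 0 < x) (ha₁ : 0 < a₁) (hb₁ : 0 ≤ b₁)
    (ha₂ : 0 < a₂) (hb₂ : 0 ≤ b₂) (ha₃ : 0 < a₃) (hb₃ : 0 ≤ b₃)
    (hm : m = (min (ENNReal.ofReal x) (min (ENNReal.ofReal a₁ / ENNReal.ofReal b₁)
      (min (ENNReal.ofReal a₂ / ENNReal.ofReal b₂)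
        (ENNReal.ofReal a₃ / ENNReal.ofReal b₃)))).toReal) :
    0 < m ∧ m ≤ x ∧ m * b₁ ≤ a₁ ∧ m * b₂ ≤ a₂ ∧ m * b₃ ≤ a₃ ∧
      (m = x ∨ m * b₁ = a₁ ∨ m * b₂ = a₂ ∨ m * b₃ = a₃) := by
  have hpos : ∀ {a b : ℝ}, 0 < a → 0 < ENNReal.ofReal a / ENNReal.ofReal b := fun ha =>
    ENNReal.div_pos (by simpa using ha) ENNReal.ofReal_ne_top
  set N := min (ENNReal.ofReal x) (min (ENNReal.ofReal a₁ / ENNReal.ofReal b₁)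
      (min (ENNReal.ofReal a₂ / ENNReal.ofReal b₂)
        (ENNReal.ofReal a₃ / ENNReal.ofReal b₃))) with hN
  have hNx : N ≤ ENNReal.ofReal x := min_le_left _ _
  have hNtop : N ≠ ⊤ := ne_top_of_le_ne_top ENNReal.ofReal_ne_top hNx
  have hN0 : 0 < N :=
    lt_min (by simpa using hx) (lt_min (hpos ha₁) (lt_min (hpos ha₂) (hpos ha₃)))
  have hm0 : 0 < m := hm ▸ ENNReal.toReal_pos hN0.ne' hNtop
  have hNm : ENNReal.ofReal m = N := by rw [hm, ENNReal.ofReal_toReal hNtop]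
  refine ⟨hm0, ?_, ?_, ?_, ?_, ?_⟩
  · exact (ENNReal.ofReal_le_ofReal_iff hx.le).1 (hNm ▸ hNx)
  · refine mul_le_of_ofReal_le_div ha₁ hm0.le (hNm.trans_le ?_)
    exact (min_le_right _ _).trans (min_le_left _ _)
  · refine mul_le_of_ofReal_le_div ha₂ hm0.le (hNm.trans_le ?_)
    exact (min_le_right _ _).trans ((min_le_right _ _).trans (min_le_left _ _))
  · refine mul_le_of_ofReal_le_div ha₃ hm0.le (hNm.trans_le ?_)
    exact (min_le_right _ _).trans ((min_le_right _ _).trans (min_le_right _ _))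
  · rcases min_choice (ENNReal.ofReal x) (min (ENNReal.ofReal a₁ / ENNReal.ofReal b₁)
      (min (ENNReal.ofReal a₂ / ENNReal.ofReal b₂)
        (ENNReal.ofReal a₃ / ENNReal.ofReal b₃))) with h | h
    · left
      rw [hm, hN, h, ENNReal.toReal_ofReal hx.le]
    rcases min_choice (ENNReal.ofReal a₁ / ENNReal.ofReal b₁)
      (min (ENNReal.ofReal a₂ / ENNReal.ofReal b₂)
        (ENNReal.ofReal a₃ / ENNReal.ofReal b₃)) with h1 | h1
    · exact Or.inr (Or.inl (mul_eq_of_ofReal_eq_div hb₁ ha₁ hm0.le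
        (hNm.trans (hN.trans (h.trans h1)))))
    rcases min_choice (ENNReal.ofReal a₂ / ENNReal.ofReal b₂)
        (ENNReal.ofReal a₃ / ENNReal.ofReal b₃) with h2 | h2
    · exact Or.inr (Or.inr (Or.inl (mul_eq_of_ofReal_eq_div hb₂ ha₂ hm0.le
        (hNm.trans (hN.trans (h.trans (h1.trans h2)))))))
    · exact Or.inr (Or.inr (Or.inr (mul_eq_of_ofReal_eq_div hb₃ ha₃ hm0.le
        (hNm.trans (hN.trans (h.trans (h1.trans h2)))))))

section Parameters

variable {d K : ℕ} {α σ σw L Δ lam β : ℝ}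

theorem zeta_nonneg : 0 ≤ zeta L Δ lam := le_max_left _ _

theorem noiseLevel_pos (hσ : 0 < σ) : 0 < noiseLevel α σ L Δ lam :=
  add_pos_of_pos_of_nonneg (Real.rpow_pos_of_pos hσ _) (Real.rpow_nonneg zeta_nonneg _)

theorem rpow_le_noiseLevel : σ ^ α ≤ noiseLevel α σ L Δ lam :=
  le_add_of_nonneg_right (Real.rpow_nonneg zeta_nonneg _)

/-- If `ζ = 0`, the last summand equals `1`; if `ζ > 0`, then `lam < 4√(LΔ)` and the first summand
exceeds `1/4`. Thus the third step-size term controls the bias without the factor `B`. -/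
theorem quarter_le_biasFactor (hσ : 0 < σ) (hα : 1 < α) (hlam : 0 < lam) :
    1 / 4 ≤ biasFactor α σ L Δ lam := by
  have hS := noiseLevel_pos (α := α) (L := L) (Δ := Δ) (lam := lam) hσ
  have hζ := zeta_nonneg (L := L) (Δ := Δ) (lam := lam)
  have h1 : 0 ≤ √(L * Δ) / lam := by positivity
  have h2 : 0 ≤ lam ^ (α - 1) * zeta L Δ lam / noiseLevel α σ L Δ lam := by positivity
  have h3 : 0 ≤ σ * noiseLevel α σ L Δ lam ^ (-1 / α) := by positivity
  unfold biasFactor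
  rcases hζ.eq_or_lt with h0 | h0
  · have : σ * noiseLevel α σ L Δ lam ^ (-1 / α) = 1 := by
      rw [noiseLevel, ← h0, Real.zero_rpow (by linarith), add_zero, ← Real.rpow_mul hσ.le,
        show α * (-1 / α) = -1 by field_simp, Real.rpow_neg_one, mul_inv_cancel₀ hσ.ne']
    linarith
  · have hpos : 0 < 2 * √(L * Δ) - lam / 2 := by
      by_contra! hcon
      rw [zeta, max_eq_left hcon] at h0
      exact lt_irrefl _ h0
    have : 1 / 4 ≤ √(L * Δ) / lam := by
      rw [le_div_iff₀ hlam]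
      linarith
    linarith

theorem optimizationTerm_nonneg (hL : 0 < L) (hΔ : 0 < Δ) : 0 ≤ optimizationTerm K L Δ lam := by
  unfold optimizationTerm
  positivity

/-- When `ζ` is comparable with `√(LΔ)` the clipping bias term exceeds the trivial bound on the
squared gradient norm. -/
theorem le_clippingBiasTerm (hσ : 0 < σ) (hL : 0 < L) (hΔ : 0 < Δ) (hlam : 0 < lam)
    (hζ : √(L * Δ) / 2 ≤ zeta L Δ lam) : L * Δ / 2 ≤ clippingBiasTerm α σ L Δ lam := by
  have hS := noiseLevel_pos (α := α) (L := L) (Δ := Δ) (lam := lam) hσ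
  have hB : lam ^ (α - 1) * zeta L Δ lam / noiseLevel α σ L Δ lam ≤ biasFactor α σ L Δ lam := by
    unfold biasFactor
    have h1 : 0 ≤ √(L * Δ) / lam := by positivity
    have h3 : 0 ≤ σ * noiseLevel α σ L Δ lam ^ (-1 / α) := by positivity
    linarith
  have hp : 0 < lam ^ (α - 1) := Real.rpow_pos_of_pos hlam _
  unfold clippingBiasTerm
  refine le_add_of_le_of_nonneg ?_ (by positivity)
  rw [le_div_iff₀ hp]
  calc L * Δ / 2 * lam ^ (α - 1) = √(L * Δ) * (lam ^ (α - 1) * (√(L * Δ) / 2)) := by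
        nth_rw 1 [← Real.mul_self_sqrt (by positivity : 0 ≤ L * Δ)]
        ring
    _ ≤ √(L * Δ) * (lam ^ (α - 1) * zeta L Δ lam) := by gcongr
    _ = √(L * Δ) * noiseLevel α σ L Δ lam *
        (lam ^ (α - 1) * zeta L Δ lam / noiseLevel α σ L Δ lam) := by field_simp
    _ ≤ _ := by gcongr

theorem three_mul_sqrt_le (hζ : zeta L Δ lam < √(L * Δ) / 2) : 3 * √(L * Δ) ≤ lam := by
  have : 2 * √(L * Δ) - lam / 2 ≤ zeta L Δ lam := le_max_right _ _
  linarith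

/-- The inequalities that define the step-size minimum, and the fact that one of them is tight. -/
theorem stepsizeMin_spec (hα : 1 < α) (hσ : 0 < σ) (hσw : 0 ≤ σw) (hL : 0 < L) (hΔ : 0 < Δ)
    (hlam : 0 < lam) {m A S B : ℝ} (hm : m = stepsizeMin d K α σ σw L Δ lam β)
    (hA : A = Real.log (K / β)) (hS : S = noiseLevel α σ L Δ lam)
    (hB : B = biasFactor α σ L Δ lam) :
    0 < m ∧ m ≤ 1 / L ∧ m * (lam ^ (1 - α / 2) * √(K * A * S)) ≤ √(Δ / L) ∧
      m * (K * S * B) ≤ √(Δ / L) * lam ^ (α - 1) ∧ m * (σw * √(d * K * A)) ≤ √(Δ / L) ∧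
      (m = 1 / L ∨ m * (lam ^ (1 - α / 2) * √(K * A * S)) = √(Δ / L) ∨
        m * (K * S * B) = √(Δ / L) * lam ^ (α - 1) ∨ m * (σw * √(d * K * A)) = √(Δ / L)) := by
  have hS0 : 0 < S := hS ▸ noiseLevel_pos hσ
  have hB0 : 0 < B := lt_of_lt_of_le (by norm_num) (hB ▸ quarter_le_biasFactor hσ hα hlam)
  have hr : 0 < √(Δ / L) := by positivity
  subst hA hS hB
  exact toReal_min_div_spec (by positivity) hr (by positivity)
    (mul_pos hr (Real.rpow_pos_of_pos hlam _)) (by positivity) hr (by positivity) hm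

theorem tunedStepsize_of_stepsizeMin {M c γ : ℝ} (hM : 0 < M) (hc : 0 < c) (hc1 : c ≤ 1 / 600)
    (hcM : c * √M ≤ 1 / 80) (hα : 1 < α) (hσ : 0 < σ) (hσw : 0 ≤ σw) (hL : 0 < L) (hΔ : 0 < Δ)
    (hlam : 0 < lam) (hK : 1 ≤ K) (hA : 1 / 2 ≤ Real.log (K / β))
    (hlevel : lam ^ α * Real.log (K / β) ≤ M * K * noiseLevel α σ L Δ lam)
    (hγ : γ = c * stepsizeMin d K α σ σw L Δ lam β) :
    TunedStepsize d K (Real.log (K / β)) (noiseLevel α σ L Δ lam / lam ^ α) L √(Δ / L) lam σw γ := by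
  have hB := quarter_le_biasFactor (L := L) (Δ := Δ) hσ hα hlam
  have hS0 := noiseLevel_pos (α := α) (L := L) (Δ := Δ) (lam := lam) hσ
  obtain ⟨hm, h1, h2, h3, h4, -⟩ := stepsizeMin_spec (d := d) (K := K) (β := β) hα hσ hσw hL hΔ hlam
    rfl rfl rfl rfl
  set m := stepsizeMin d K α σ σw L Δ lam β
  set A := Real.log (K / β)
  set S := noiseLevel α σ L Δ lam
  set B := biasFactor α σ L Δ lam
  have hr : 0 < √(Δ / L) := by positivity
  set r := √(Δ / L)
  have hK' : (1 : ℝ) ≤ K := by exact_mod_cast hK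
  have hK0 : (0 : ℝ) < K := by linarith
  have hA0 : 0 < A := by linarith
  have hp : 0 < lam ^ α := Real.rpow_pos_of_pos hlam _
  have hc2 : c ^ 2 ≤ 1 / 360000 := by nlinarith
  have hvar : m ^ 2 * lam ^ 2 * K * A * (S / lam ^ α) ≤ r ^ 2 := by
    have hsq := pow_le_pow_left₀ (by positivity) h2 2
    have e : (lam ^ (1 - α / 2)) ^ 2 * lam ^ α = lam ^ 2 := by
      rw [← Real.rpow_natCast, ← Real.rpow_mul hlam.le, ← Real.rpow_add hlam,
        ← Real.rpow_natCast]
      congr 1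
      push_cast
      ring
    rw [mul_pow, mul_pow, Real.sq_sqrt (by positivity)] at hsq
    refine le_trans (le_of_eq ?_) hsq
    rw [← e]
    field_simp
  have hγ0 : 0 < γ := hγ ▸ mul_pos hc hm
  refine ⟨hK', hA, by positivity, hL, hr, hlam, hγ0, ?_, ?_, ?_, ?_, ?_⟩
  · rw [le_div_iff₀ hL] at h1
    rw [hγ, mul_assoc]
    nlinarith
  · calc γ ^ 2 * lam ^ 2 * K * A * (S / lam ^ α)
        = c ^ 2 * (m ^ 2 * lam ^ 2 * K * A * (S / lam ^ α)) := by rw [hγ]; ring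
      _ ≤ 1 / 360000 * r ^ 2 := by gcongr
      _ = _ := by ring
  · have h5 : m * (K * S * (1 / 4)) ≤ r * lam ^ (α - 1) :=
      le_trans (by gcongr) h3
    have e : lam ^ (α - 1) * lam = lam ^ α := by
      rw [← Real.rpow_add_one hlam.ne', sub_add_cancel]
    have h6 : m * K * S * lam / lam ^ α ≤ 4 * r := by
      rw [div_le_iff₀ hp, ← e]
      have := mul_le_mul_of_nonneg_right h5 hlam.le
      linarith
    calc γ * K * (S / lam ^ α) * lam = c * (m * K * S * lam / lam ^ α) := by rw [hγ]; ring
      _ ≤ 1 / 600 * (4 * r) := by gcongr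
      _ = _ := by ring
  -- The clipping-level condition trades one factor `A` for `M * K * S / lam ^ α`, reducing the
  -- range bound to the variance bound; this is why `c` must be small relative to `1 / √M`.
  · have h5 : A ≤ M * K * (S / lam ^ α) := by
      rw [← mul_div_assoc, le_div_iff₀ hp]
      linarith
    refine abs_le_of_sq_le_sq' ?_ (by positivity) |>.2
    calc (γ * lam * A) ^ 2 = c ^ 2 * (m ^ 2 * lam ^ 2 * A) * A := by rw [hγ]; ring
      _ ≤ c ^ 2 * (m ^ 2 * lam ^ 2 * A) * (M * K * (S / lam ^ α)) := by gcongr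
      _ = c ^ 2 * M * (m ^ 2 * lam ^ 2 * K * A * (S / lam ^ α)) := by ring
      _ ≤ c ^ 2 * M * r ^ 2 := by gcongr
      _ = (c * √M) ^ 2 * r ^ 2 := by rw [mul_pow, Real.sq_sqrt hM.le]
      _ ≤ (1 / 80) ^ 2 * r ^ 2 := by gcongr
      _ = _ := by ring
  · have hsq := pow_le_pow_left₀ (by positivity) h4 2
    rw [mul_pow, mul_pow, Real.sq_sqrt (by positivity)] at hsq
    calc γ ^ 2 * σw ^ 2 * d * K * A = c ^ 2 * (m ^ 2 * (σw ^ 2 * (d * K * A))) := by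
          rw [hγ]; ring
      _ ≤ 1 / 360000 * r ^ 2 := by gcongr
      _ = _ := by ring

/-- The rate `Δ / (m K)` for the step-size minimum `m` is dominated by the four error terms. -/
theorem div_stepsizeMin_le (hα : 1 < α) (hσ : 0 < σ) (hσw : 0 ≤ σw) (hL : 0 < L) (hΔ : 0 < Δ)
    (hlam : 0 < lam) (hK : 1 ≤ K) (hA : 0 < Real.log (K / β)) :
    Δ / (stepsizeMin d K α σ σw L Δ lam β * K)
      ≤ max (max (optimizationTerm K L Δ lam) (stochasticTerm K α σ L Δ lam β))
          (max (clippingBiasTerm α σ L Δ lam) (dpTerm d K σw L Δ lam β)) := by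
  have hB := quarter_le_biasFactor (L := L) (Δ := Δ) hσ hα hlam
  have hS0 := noiseLevel_pos (α := α) (L := L) (Δ := Δ) (lam := lam) hσ
  obtain ⟨hm, -, -, -, -, h⟩ := stepsizeMin_spec (d := d) (K := K) (β := β) hα hσ hσw hL hΔ hlam
    rfl rfl rfl rfl
  unfold optimizationTerm stochasticTerm clippingBiasTerm dpTerm
  set m := stepsizeMin d K α σ σw L Δ lam β
  set A := Real.log (K / β)
  set S := noiseLevel α σ L Δ lam
  set B := biasFactor α σ L Δ lam
  have hr : 0 < √(Δ / L) := by positivity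
  have hK0 : (0 : ℝ) < K := by exact_mod_cast hK
  have hp : 0 < lam ^ (α - 1) := Real.rpow_pos_of_pos hlam _
  have hp' : 0 < lam ^ α := Real.rpow_pos_of_pos hlam _
  have hp2 : 0 < lam ^ (2 * α) := Real.rpow_pos_of_pos hlam _
  have hrate : ∀ q, m * q = √(Δ / L) → Δ / (m * K) = √(L * Δ) * q / K := by
    intro q hq
    have : Δ = √(L * Δ) * (m * q) := by rw [hq, sqrt_mul_sqrt_div hL hΔ]
    rw [div_eq_div_iff (by positivity) hK0.ne']
    nth_rw 1 [this]
    ring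
  -- Whichever step-size term is tight, `Δ / (m * K)` equals the first summand of the corresponding
  -- error term; the second summand only needs to be nonnegative.
  rcases h with h | h | h | h
  · refine le_trans ?_ ((le_max_left _ _).trans (le_max_left _ _))
    refine le_add_of_le_of_nonneg (le_of_eq ?_) (by positivity)
    rw [h]
    field_simp
  · refine le_trans ?_ ((le_max_right _ _).trans (le_max_left _ _))
    refine le_add_of_le_of_nonneg (le_of_eq ?_) (by positivity)
    rw [hrate _ h, show K * A * S = (K : ℝ) ^ 2 * (S * A / K) by field_simp,
      Real.sqrt_mul (by positivity : 0 ≤ (K : ℝ) ^ 2), Real.sqrt_sq hK0.le]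
    field_simp
  · refine le_trans ?_ ((le_max_left _ _).trans (le_max_right _ _))
    refine le_add_of_le_of_nonneg (le_of_eq ?_) (by positivity)
    rw [hrate (K * S * B / lam ^ (α - 1)) (by rw [← mul_div_assoc, h]; field_simp)]
    field_simp
  · refine le_trans ?_ ((le_max_right _ _).trans (le_max_right _ _))
    refine le_add_of_le_of_nonneg (le_of_eq ?_) (by positivity)
    have e : √(L * Δ) * √(d * K * A) = √(d * L * Δ * A) * √K := by
      rw [← Real.sqrt_mul (by positivity), ← Real.sqrt_mul (by positivity)]
      congr 1
      ring
    have hKs : √(K : ℝ) * √K = K := Real.mul_self_sqrt hK0.le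
    rw [hrate _ h, div_eq_div_iff hK0.ne' (by positivity)]
    calc √(L * Δ) * (σw * √(d * K * A)) * √K = σw * (√(L * Δ) * √(d * K * A)) * √K := by ring
      _ = σw * √(d * L * Δ * A) * (√K * √K) := by rw [e]; ring
      _ = _ := by rw [hKs]

end Parameters

theorem le_measure_of_forall_mem {Ω : Type*} [MeasurableSpace Ω] {P : Measure Ω}
    [IsProbabilityMeasure P] {E : Set Ω} {β : ℝ} (hβ : 0 < β) (hE : ∀ ω, ω ∈ E) :
    ENNReal.ofReal (1 - β) ≤ P E := by
  rw [Set.eq_univ_of_forall hE, measure_univ]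
  exact ENNReal.ofReal_le_one.2 (by linarith)

end DPClippedSGD

/-! ### The main theorem: degenerate cases and assembly. -/

theorem mainTheorem6 (M : ℝ) (hM : 0 < M) :
    ∃ c₀ : ℝ, 0 < c₀ ∧ ∀ c : ℝ, 0 < c → c ≤ c₀ → ∃ C : ℝ, 0 < C ∧
      ∀ (d : ℕ) (Ξ : Type*) [MeasurableSpace Ξ] (D : Measure Ξ) [IsProbabilityMeasure D]
        (F : Ξ → EuclideanSpace ℝ (Fin d) → ℝ)
        (Ω : Type*) [MeasurableSpace Ω] (P : Measure Ω) [IsProbabilityMeasure P]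
        (ξ : ℕ → Ω → Ξ) (w : ℕ → Ω → EuclideanSpace ℝ (Fin d))
        (x₀ : EuclideanSpace ℝ (Fin d)) (K : ℕ) (α σ σw L Δ lam β fstar γ : ℝ),
        1 ≤ K → 0 < β → β ≤ 1 → 1 < α → α ≤ 2 → 0 < σ → 0 ≤ σw → 0 < L → 0 < Δ → 0 < lam →
        DPClippedSGD.StochasticObjective D F →
        IsGLB (DPClippedSGD.expectedLoss D F ''
          DPClippedSGD.region (DPClippedSGD.expectedLoss D F) fstar L Δ) fstar →
        DPClippedSGD.SmoothOn (DPClippedSGD.expectedLoss D F) L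
          (DPClippedSGD.region (DPClippedSGD.expectedLoss D F) fstar L Δ) →
        DPClippedSGD.HeavyTailedOracleOn D F α σ
          (DPClippedSGD.region (DPClippedSGD.expectedLoss D F) fstar L Δ) →
        DPClippedSGD.expectedLoss D F x₀ - fstar ≤ Δ →
        DPClippedSGD.FreshSamples P D σw ξ w →
        lam ^ α * Real.log (K / β) ≤ M * K * DPClippedSGD.noiseLevel α σ L Δ lam →
        γ = c * DPClippedSGD.stepsizeMin d K α σ σw L Δ lam β →
        ENNReal.ofReal (1 - β) ≤
          P {ω | (⨅ t : Fin (K + 1),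
              ‖∇ (DPClippedSGD.expectedLoss D F)
                (DPClippedSGD.iterate F γ lam x₀ (fun k => ξ k ω) (fun k => w k ω) t)‖ ^ 2)
            ≤ C * max (max (DPClippedSGD.optimizationTerm K L Δ lam)
                  (DPClippedSGD.stochasticTerm K α σ L Δ lam β))
                (max (DPClippedSGD.clippingBiasTerm α σ L Δ lam)
                  (DPClippedSGD.dpTerm d K σw L Δ lam β))} := by
  -- The two bounds on `c` serve the smoothness, variance, bias and noise conditions and the range
  -- condition respectively; `4 / c` comes from `4Δ / (γK)` with `γ = c * m`.
  refine ⟨min (1 / 600) (1 / (80 * √M)), by positivity, fun c hc hc0 => ⟨4 / c, by positivity, ?_⟩⟩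
  intro d Ξ _ D _ F Ω _ P _ ξ w x₀ K α σ σw L Δ lam β fstar γ hK hβ hβ1 hα hα2 hσ hσw hL hΔ hlam
    hF hglb hf hO hx₀ hS hlevel hγ
  have hc1 : c ≤ 1 / 600 := hc0.trans (min_le_left _ _)
  have hcM : c * √M ≤ 1 / 80 := by
    have := hc0.trans (min_le_right _ _)
    rw [le_div_iff₀ (by positivity)] at this
    linarith
  have hC : 4 ≤ 4 / c := by
    rw [le_div_iff₀ hc]
    linarith
  have hinf : ∀ y ∈ DPClippedSGD.region (DPClippedSGD.expectedLoss D F) fstar L Δ,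
      fstar ≤ DPClippedSGD.expectedLoss D F y := fun y hy => hglb.1 ⟨y, hy, rfl⟩
  have hx₀S : x₀ ∈ DPClippedSGD.sublevel (DPClippedSGD.expectedLoss D F) fstar Δ := by
    change DPClippedSGD.expectedLoss D F x₀ ≤ fstar + 2 * Δ
    linarith
  have hinit : ∀ ω, (⨅ t : Fin (K + 1), ‖∇ (DPClippedSGD.expectedLoss D F)
      (DPClippedSGD.iterate F γ lam x₀ (fun k => ξ k ω) (fun k => w k ω) t)‖ ^ 2)
        ≤ ‖∇ (DPClippedSGD.expectedLoss D F) x₀‖ ^ 2 := fun ω =>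
    ciInf_le (f := fun t : Fin (K + 1) => ‖∇ (DPClippedSGD.expectedLoss D F)
      (DPClippedSGD.iterate F γ lam x₀ (fun k => ξ k ω) (fun k => w k ω) t)‖ ^ 2)
      ⟨0, by rintro _ ⟨t, rfl⟩; positivity⟩ 0
  have hgrad₀ : ‖∇ (DPClippedSGD.expectedLoss D F) x₀‖ ^ 2 ≤ 2 * (L * Δ) := by
    have := DPClippedSGD.norm_gradient_sq_le hL hΔ hf hinf hx₀S
    nlinarith
  have hopt := DPClippedSGD.optimizationTerm_nonneg (K := K) (lam := lam) hL hΔ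
  set T := max (max (DPClippedSGD.optimizationTerm K L Δ lam)
      (DPClippedSGD.stochasticTerm K α σ L Δ lam β))
    (max (DPClippedSGD.clippingBiasTerm α σ L Δ lam) (DPClippedSGD.dpTerm d K σw L Δ lam β)) with hT
  have hT1 : DPClippedSGD.optimizationTerm K L Δ lam ≤ T :=
    (le_max_left _ _).trans (le_max_left _ _)
  have hT3 : DPClippedSGD.clippingBiasTerm α σ L Δ lam ≤ T :=
    (le_max_left _ _).trans (le_max_right _ _)
  have hT0 : 0 ≤ T := hopt.trans hT1
  have hCT : 4 * T ≤ 4 / c * T := mul_le_mul_of_nonneg_right hC hT0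
  rcases Nat.eq_zero_or_pos d with rfl | hd
  · refine DPClippedSGD.le_measure_of_forall_mem hβ fun ω => (hinit ω).trans ?_
    rw [Subsingleton.elim (∇ (DPClippedSGD.expectedLoss D F) x₀) 0]
    rw [norm_zero, zero_pow two_ne_zero]
    positivity
  -- For `K = 1` the logarithm may vanish, but the initial squared gradient is at most `2LΔ` and the
  -- optimization term is at least `LΔ`.
  rcases hK.eq_or_lt with rfl | hK2
  · refine DPClippedSGD.le_measure_of_forall_mem hβ fun ω => (hinit ω).trans ?_
    have : L * Δ ≤ DPClippedSGD.optimizationTerm 1 L Δ lam := by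
      unfold DPClippedSGD.optimizationTerm
      refine le_add_of_le_of_nonneg (by simp) (by positivity)
    linarith
  -- For large `ζ` the bias term is at least `LΔ / 2`, so four times it covers the initial squared
  -- gradient.
  rcases le_or_gt (√(L * Δ) / 2) (DPClippedSGD.zeta L Δ lam) with hζ | hζ
  · refine DPClippedSGD.le_measure_of_forall_mem hβ fun ω => (hinit ω).trans ?_
    have := DPClippedSGD.le_clippingBiasTerm (α := α) hσ hL hΔ hlam hζ
    linarith
  have hK2' : (2 : ℝ) ≤ K := by exact_mod_cast hK2
  have hKβ : (2 : ℝ) ≤ K / β := by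
    rw [le_div_iff₀ hβ]
    nlinarith
  have hA : 1 / 2 ≤ Real.log (K / β) := by
    have := Real.log_le_log two_pos hKβ
    linarith [Real.log_two_gt_d9]
  have hp : 0 < lam ^ α := Real.rpow_pos_of_pos hlam _
  have htuned := DPClippedSGD.tunedStepsize_of_stepsizeMin hM hc hc1 hcM hα hσ hσw hL hΔ hlam hK hA
    hlevel hγ
  have hprob := htuned.prob_min_gradient_le hd hα hα2 hΔ hF hinf hf hO hS
    (by rw [div_mul_cancel₀ _ hp.ne']; exact DPClippedSGD.rpow_le_noiseLevel)
    (DPClippedSGD.three_mul_sqrt_le hζ) hx₀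
  -- The failure probability obtained is in fact `β / K`.
  have hexp : Real.exp (-Real.log (K / β)) ≤ β := by
    rw [Real.exp_neg, Real.exp_log (by linarith), inv_div]
    exact div_le_self hβ.le (by linarith)
  have hrate := DPClippedSGD.div_stepsizeMin_le (d := d) hα hσ hσw hL hΔ hlam hK
    (by linarith : 0 < Real.log (K / β))
  rw [← hT] at hrate
  calc ENNReal.ofReal (1 - β) = 1 - ENNReal.ofReal β := by
        rw [ENNReal.ofReal_sub _ hβ.le, ENNReal.ofReal_one]
    _ ≤ 1 - ENNReal.ofReal (Real.exp (-Real.log (K / β))) := by gcongr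
    _ ≤ _ := hprob.trans (measure_mono fun ω hω => ?_)
  refine le_trans (show _ ≤ 4 * Δ / (γ * K) from hω) ?_
  calc 4 * Δ / (γ * K) = 4 / c * (Δ / (DPClippedSGD.stepsizeMin d K α σ σw L Δ lam β * K)) := by
        rw [hγ]
        have := hc.ne'
        rw [div_mul_div_comm, mul_assoc c]
    _ ≤ 4 / c * T := by gcongr
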